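/- Let $R$ be a commutative ring, $A$ an $R$-algebra (associative, unital, not necessarily commutative), $C$ an $R$-coalgebra (no further assumption on $C$), and $\otimes=\otimes_R$. Let $(A,C,\psi)$ be a right-right entwining structure over $R$, i.e. $\psi:C\otimes A\to A\otimes C$, $c\otimes a\mapsto\sum a_\psi\otimes c^\psi$, is $R$-linear with $$\sum (a\tilde a)_\psi\otimes c^\psi=\sum a_\psi\tilde a_\Psi\otimes c^{\psi\Psi},\quad \sum 1_\psi\otimes c^\psi=1\otimes c,$$ $$\sum a_\psi\otimes\Delta(c^\psi)=\sum a_{\psi\Psi}\otimes c_1^{\Psi}\otimes c_2^{\psi},\quad \sum a_\psi\varepsilon(c^\psi)=\varepsilon(c)a .$$ Let $\mathcal M_A^C(\psi)$ be the category of entwined modules: right $A$-modules $M$ that are right $C$-comodules via $\varrho_M(m)=\sum m_{<0>}\otimes m_{<1>}$ with $\varrho_M(ma)=\sum m_{<0>}a_\psi\otimes m_{<1>}^\psi$. Suppose that $A$, with right multiplication, is an entwined module with coaction $\varrho$, write $\varrho(1)=\sum 1_{<0>}\otimes 1_{<1>}$, and assume that there is a group-like element $x\in C$ with $$\varrho(a)=\sum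 a_\psi\otimes x^\psi\qquad\text{for all }a\in A.$$ For an entwined module $M$ put $M^{co\mathcal C}=\{m\in M\mid \varrho_M(m)=\sum m1_{<0>}\otimes 1_{<1>}\}$, and let $B=A^{co\mathcal C}$, a subalgebra of $A$. For a right $B$-module $N$, $N\otimes_BA$ is an entwined module via $(n\otimes_B a')a=n\otimes_B a'a$ and $n\otimes_Ba\mapsto\sum (n\otimes_B a_{<0>})\otimes a_{<1>}$. Define: * $\mathcal M_A^C(\psi)$ satisfies the *weak structure theorem* if $\Psi_M:M^{co\mathcal C}\otimes_BA\to M$, $m\otimes_B a\mapsto ma$, is an isomorphism for every entwined module $M$; it satisfies the *strong structure theorem* if in addition $\Phi_N:N\to(N\otimes_BA)^{co\mathcal C}$, $n\mapsto n\otimes_B1$, is an isomorphism for every right $B$-module $N$. * $A/B$ is *$\mathcal C$-Galois* (for the $A$-coring $\mathcal C=A\otimes C$) if $\beta:A\otimes_BA\to A\otimes C$, $\tilde a\otimes_B a\mapsto\sum\tilde a1_{<0>}a_\psi\otimes1_{<1>}^\psi$, is bijective. * $A$ has the *right normal basis property* if there is a left $B$-linear, right $C$-colinear isomorphism $A\simeq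 B\otimes C$, where $B\otimes C$ has the coaction $\mathrm{id}\otimes\Delta$. * $A/B$ is *cleft* if there is a right $C$-colinear map $\lambda:C\to A$ that is invertible for the convolution product $(f\star g)(c)=\sum f(c_1)g(c_2)$ of $\mathrm{Hom}_R(C,A)$. * $\#_\psi^{op}(C,A)$ is the ring $\mathrm{Hom}_R(C,A)$ with product $(f\cdot g)(c)=\sum f(c_2)_\psi\, g(c_1^\psi)$ and unit $c\mapsto\varepsilon(c)1$; and $\Lambda:\#_\psi^{op}(C,A)\to\mathrm{End}({}_BA)^{op}$ is the map $g\mapsto[a\mapsto\sum a_{<0>}g(a_{<1>})]$. **Theorem.** The following statements are equivalent: 1. $A/B$ is cleft; 2. $\mathcal M_A^C(\psi)$ satisfies the strong structure theorem and $A$ has the right normal basis property; 3. $\mathcal M_A^C(\psi)$ satisfies the weak structure theorem and $A$ has the right normal basis property; 4. $A/B$ is $\mathcal C$-Galois and $A$ has the right normal basis property; 5. $\Lambda$ is a ring isomorphism and $A$ has the right normal basis property. -/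

import Mathlib

open scoped TensorProduct
open MulOpposite (op unop)

universe u v w t

/-! ### Tensor products over a non-commutative `R`-algebra -/

section BalancedTensor

variable (R : Type u) [CommRing R] (S : Type*) [Ring S]
  (N : Type*) [AddCommGroup N] [Module R N] [Module Sᵐᵒᵖ N]
  (P : Type*) [AddCommGroup P] [Module R P] [Module S P]

/-- The relations `n s ⊗ p = n ⊗ s p`. -/
def balancedRel : Submodule R (N ⊗[R] P) :=
  Submodule.span R
    {z | ∃ (n : N) (s : S) (p : P), z = (op s • n) ⊗ₜ[R] p - n ⊗ₜ[R] (s • p)}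

/-- The tensor product `N ⊗_S P` of a right module `N` and a left module `P` over an `R`-algebra
`S` (with compatible `R`-module structures), as a quotient of `N ⊗_R P`. Right `S`-modules are modules over `Sᵐᵒᵖ`. -/
def BalancedTensor : Type _ := (N ⊗[R] P) ⧸ balancedRel R S N P

instance : AddCommGroup (BalancedTensor R S N P) :=
  inferInstanceAs (AddCommGroup ((N ⊗[R] P) ⧸ balancedRel R S N P))

instance : Module R (BalancedTensor R S N P) :=
  inferInstanceAs (Module R ((N ⊗[R] P) ⧸ balancedRel R S N P))

namespace BalancedTensor

/-- The canonical projection `N ⊗_R P → N ⊗_S P`. -/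
def proj : N ⊗[R] P →ₗ[R] BalancedTensor R S N P := (balancedRel R S N P).mkQ

variable {N P}

/-- The element `n ⊗_S p`. -/
def tmul (n : N) (p : P) : BalancedTensor R S N P := proj R S N P (n ⊗ₜ[R] p)

lemma smul_tmul (n : N) (s : S) (p : P) :
    tmul R S (op s • n) p = tmul R S n (s • p) := by
  refine (Submodule.Quotient.eq (balancedRel R S N P)).2 (Submodule.subset_span ?_)
  exact ⟨n, s, p, rfl⟩

variable {R S}

/-- The linear map on `N ⊗_S P` induced by an `S`-balanced bilinear map. -/
def lift {X : Type*} [AddCommGroup X] [Module R X] (f : N →ₗ[R] P →ₗ[R] X)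
    (hf : ∀ (n : N) (s : S) (p : P), f (op s • n) p = f n (s • p)) :
    BalancedTensor R S N P →ₗ[R] X :=
  (balancedRel R S N P).liftQ (TensorProduct.lift f) (by
    refine Submodule.span_le.2 ?_
    rintro _ ⟨n, s, p, rfl⟩
    simp [hf])

@[simp] lemma lift_tmul {X : Type*} [AddCommGroup X] [Module R X] (f : N →ₗ[R] P →ₗ[R] X)
    (hf : ∀ (n : N) (s : S) (p : P), f (op s • n) p = f n (s • p)) (n : N) (p : P) :
    lift f hf (tmul R S n p) = f n p :=
  TensorProduct.lift.tmul n p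

lemma hom_ext {X : Type*} [AddCommGroup X] [Module R X] {f g : BalancedTensor R S N P →ₗ[R] X}
    (h : ∀ n p, f (tmul R S n p) = g (tmul R S n p)) : f = g :=
  Submodule.linearMap_qext _ (TensorProduct.ext' h)

end BalancedTensor

end BalancedTensor

/-! ### Right modules -/

section RightModule

variable (R : Type u) [CommRing R] {A : Type v} [Ring A] [Algebra R A]

/-- The orbit map `a ↦ m a` of an element `m` of a right `A`-module. -/
def rightOrbit {M : Type*} [AddCommGroup M] [Module R M] [Module Aᵐᵒᵖ M]
    [IsScalarTower R Aᵐᵒᵖ M] : M →ₗ[R] A →ₗ[R] M :=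
  LinearMap.mk₂ R (fun m a => op a • m)
    (fun m m' a => smul_add _ _ _) (fun r m a => smul_comm _ _ _)
    (fun m a a' => by rw [MulOpposite.op_add, add_smul])
    (fun r m a => by rw [MulOpposite.op_smul, smul_assoc])

@[simp] lemma rightOrbit_apply {M : Type*} [AddCommGroup M] [Module R M] [Module Aᵐᵒᵖ M]
    [IsScalarTower R Aᵐᵒᵖ M] (m : M) (a : A) : rightOrbit R m a = op a • m := rfl

variable {R}

/-- A right `A`-module is a right module over every subalgebra of `A`. -/
instance Subalgebra.rightModule (B : Subalgebra R A) (M : Type*) [AddCommGroup M]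
    [Module Aᵐᵒᵖ M] : Module (↥B)ᵐᵒᵖ M :=
  Module.compHom M (RingHom.op B.val.toRingHom)

lemma Subalgebra.rightModule_smul (B : Subalgebra R A) {M : Type*} [AddCommGroup M]
    [Module Aᵐᵒᵖ M] (b : B) (m : M) : op b • m = op (b : A) • m := rfl

instance Subalgebra.rightModule_isScalarTower (B : Subalgebra R A) (M : Type*) [AddCommGroup M]
    [Module R M] [Module Aᵐᵒᵖ M] [IsScalarTower R Aᵐᵒᵖ M] : IsScalarTower R (↥B)ᵐᵒᵖ M where
  smul_assoc r b m := by
    induction b with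
    | _ b =>
      rw [← MulOpposite.op_smul, Subalgebra.rightModule_smul, Subalgebra.rightModule_smul,
        Subalgebra.coe_smul, MulOpposite.op_smul, smul_assoc]

end RightModule

/-! ### Entwining structures and entwined modules -/

section Entwining

variable {R : Type u} [CommRing R] {A : Type v} [Ring A] [Algebra R A]
  {C : Type w} [AddCommGroup C] [Module R C]

/-- The right action of `a` on `M ⊗ C` twisted by `ψ`: `(m ⊗ c) a = ∑ m a_ψ ⊗ c^ψ`. -/
def twistedAction (ψ : C ⊗[R] A →ₗ[R] A ⊗[R] C) {M : Type*} [AddCommGroup M] [Module R M]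
    [Module Aᵐᵒᵖ M] [IsScalarTower R Aᵐᵒᵖ M] (a : A) : M ⊗[R] C →ₗ[R] M ⊗[R] C :=
  TensorProduct.lift
    (LinearMap.mk₂ R (fun m c => (rightOrbit R m).rTensor C (ψ (c ⊗ₜ[R] a)))
      (fun m m' c => by rw [map_add, LinearMap.rTensor_add, LinearMap.add_apply])
      (fun r m c => by rw [map_smul, LinearMap.rTensor_smul, LinearMap.smul_apply])
      (fun m c c' => by rw [TensorProduct.add_tmul, map_add, map_add])
      (fun r m c => by rw [← TensorProduct.smul_tmul', map_smul, map_smul]))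

@[simp] lemma twistedAction_tmul (ψ : C ⊗[R] A →ₗ[R] A ⊗[R] C) {M : Type*} [AddCommGroup M]
    [Module R M] [Module Aᵐᵒᵖ M] [IsScalarTower R Aᵐᵒᵖ M] (a : A) (m : M) (c : C) :
    twistedAction ψ a (m ⊗ₜ[R] c) = (rightOrbit R m).rTensor C (ψ (c ⊗ₜ[R] a)) := rfl

variable (R A C)

/-- A right-right entwining structure `(A, C, ψ)` over `R`. -/
structure EntwiningStructure [Coalgebra R C] where
  /-- `ψ (c ⊗ a) = ∑ a_ψ ⊗ c^ψ` -/
  ψ : C ⊗[R] A →ₗ[R] A ⊗[R] C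
  /-- `∑ (a b)_ψ ⊗ c^ψ = ∑ a_ψ b_Ψ ⊗ c^{ψ Ψ}` -/
  map_mul : ∀ (c : C) (a b : A),
    ψ (c ⊗ₜ[R] (a * b)) = twistedAction ψ b (ψ (c ⊗ₜ[R] a))
  /-- `∑ 1_ψ ⊗ c^ψ = 1 ⊗ c` -/
  map_one : ∀ c : C, ψ (c ⊗ₜ[R] 1) = 1 ⊗ₜ[R] c
  /-- `∑ a_ψ ⊗ Δ (c^ψ) = ∑ a_{ψ Ψ} ⊗ c₁^Ψ ⊗ c₂^ψ` -/
  map_comul : ∀ (c : C) (a : A),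
    Coalgebra.comul.lTensor A (ψ (c ⊗ₜ[R] a)) =
      TensorProduct.assoc R A C C (ψ.rTensor C ((TensorProduct.assoc R C A C).symm
        (ψ.lTensor C (TensorProduct.assoc R C C A (Coalgebra.comul c ⊗ₜ[R] a)))))
  /-- `∑ a_ψ ε (c^ψ) = ε (c) a` -/
  map_counit : ∀ (c : C) (a : A),
    TensorProduct.rid R A (Coalgebra.counit.lTensor A (ψ (c ⊗ₜ[R] a))) =
      (Coalgebra.counit c : R) • a

end Entwining

namespace EntwiningStructure

variable {R : Type u} [CommRing R] {A : Type v} [Ring A] [Algebra R A]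
  {C : Type w} [AddCommGroup C] [Module R C] [Coalgebra R C]

/-- A coaction `ϱ : M → M ⊗ C` making the right `A`-module `M` an entwined module: `(M, ϱ)` is a
right `C`-comodule and `ϱ (m a) = ∑ m₀ a_ψ ⊗ m₁^ψ`. -/
structure EntwinedCoaction (E : EntwiningStructure R A C) (M : Type*) [AddCommGroup M]
    [Module R M] [Module Aᵐᵒᵖ M] [IsScalarTower R Aᵐᵒᵖ M] where
  /-- `ϱ (m) = ∑ m₀ ⊗ m₁` -/
  ϱ : M →ₗ[R] M ⊗[R] C
  coassoc : ∀ m : M,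
    TensorProduct.assoc R M C C (ϱ.rTensor C (ϱ m)) = Coalgebra.comul.lTensor M (ϱ m)
  counit : ∀ m : M, TensorProduct.rid R M (Coalgebra.counit.lTensor M (ϱ m)) = m
  map_smul : ∀ (m : M) (a : A), ϱ (op a • m) = twistedAction E.ψ a (ϱ m)

variable {E : EntwiningStructure R A C} (ρA : E.EntwinedCoaction A)

lemma rightOrbit_comp {M : Type*} [AddCommGroup M] [Module R M] [Module Aᵐᵒᵖ M]
    [IsScalarTower R Aᵐᵒᵖ M] (m : M) (a : A) :
    rightOrbit (A := A) R m ∘ₗ rightOrbit (A := A) R a = rightOrbit R (op a • m) := by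
  ext b
  simp [mul_smul]

lemma rTensor_rightOrbit_smul {M : Type*} [AddCommGroup M] [Module R M] [Module Aᵐᵒᵖ M]
    [IsScalarTower R Aᵐᵒᵖ M] (m : M) (a : A) (z : A ⊗[R] C) :
    twistedAction E.ψ a ((rightOrbit R m).rTensor C z) =
      (rightOrbit R m).rTensor C (twistedAction E.ψ a z) := by
  induction z with
  | zero => simp
  | add x y hx hy => simp only [map_add, hx, hy]
  | tmul b c =>
    rw [LinearMap.rTensor_tmul, twistedAction_tmul, twistedAction_tmul, rightOrbit_apply,
      ← rightOrbit_comp, LinearMap.rTensor_comp_apply]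

/-- The coaction of `A` satisfies `ϱ (a) = (∑ 1₀ ⊗ 1₁) a = ∑ 1₀ a_ψ ⊗ 1₁^ψ`. -/
lemma EntwinedCoaction.rho_eq (a : A) : ρA.ϱ a = twistedAction E.ψ a (ρA.ϱ 1) := by
  rw [← ρA.map_smul, op_smul_eq_mul, one_mul]

lemma map_smul_of_coinvariant {M : Type*} [AddCommGroup M] [Module R M] [Module Aᵐᵒᵖ M]
    [IsScalarTower R Aᵐᵒᵖ M] (ρM : E.EntwinedCoaction M) {m : M}
    (hm : ρM.ϱ m = (rightOrbit R m).rTensor C (ρA.ϱ 1)) (a : A) :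
    ρM.ϱ (op a • m) = (rightOrbit R m).rTensor C (ρA.ϱ a) := by
  rw [ρM.map_smul, hm, rTensor_rightOrbit_smul, ← ρA.rho_eq]

/-- The subalgebra of coinvariants `B = {b ∈ A | ϱ (b) = ∑ b 1₀ ⊗ 1₁}`. -/
def coinvariantSubalgebra : Subalgebra R A where
  carrier := {b | ρA.ϱ b = (rightOrbit R b).rTensor C (ρA.ϱ 1)}
  mul_mem' := by
    intro a b ha hb
    simp only [Set.mem_ofPred_eq] at ha hb ⊢
    rw [← op_smul_eq_mul, map_smul_of_coinvariant ρA ρA ha, hb,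
      ← LinearMap.comp_apply, ← LinearMap.rTensor_comp, rightOrbit_comp]
  add_mem' := by
    intro a b ha hb
    simp only [Set.mem_ofPred_eq] at ha hb ⊢
    rw [map_add, map_add, LinearMap.rTensor_add, LinearMap.add_apply, ha, hb]
  algebraMap_mem' := by
    intro r
    have h : rightOrbit R (1 : A) = LinearMap.id := by ext; simp
    simp only [Set.mem_ofPred_eq]
    rw [Algebra.algebraMap_eq_smul_one, _root_.map_smul, _root_.map_smul, LinearMap.rTensor_smul, h,
      LinearMap.rTensor_id, LinearMap.smul_apply, LinearMap.id_apply]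

/-- The coinvariants `{m ∈ M | ∑ m₀ ⊗ m₁ = ∑ m 1₀ ⊗ 1₁}` of an entwined module, a right module
over the subalgebra of coinvariants of `A`. -/
def coinvariants {M : Type*} [AddCommGroup M] [Module R M] [Module Aᵐᵒᵖ M]
    [IsScalarTower R Aᵐᵒᵖ M] (ρM : E.EntwinedCoaction M) :
    Submodule (↥(coinvariantSubalgebra ρA))ᵐᵒᵖ M where
  carrier := {m | ρM.ϱ m = (rightOrbit R m).rTensor C (ρA.ϱ 1)}
  add_mem' := by
    intro a b ha hb
    simp only [Set.mem_ofPred_eq] at ha hb ⊢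
    rw [map_add, map_add, LinearMap.rTensor_add, LinearMap.add_apply, ha, hb]
  zero_mem' := by simp
  smul_mem' := by
    intro b m hm
    induction b with
    | _ b =>
      simp only [Set.mem_ofPred_eq] at hm ⊢
      rw [Subalgebra.rightModule_smul, map_smul_of_coinvariant ρA ρM hm, b.2,
        ← LinearMap.comp_apply, ← LinearMap.rTensor_comp, rightOrbit_comp]

/-! ### The entwined module `N ⊗_B A` -/

section Induced

variable (N : Type*) [AddCommGroup N] [Module R N] [Module (↥(coinvariantSubalgebra ρA))ᵐᵒᵖ N]

/-- The right `B`-module `N` extended to `N ⊗_B A`. -/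
abbrev Induced : Type _ := BalancedTensor R ↥(coinvariantSubalgebra ρA) N A

variable {N}

/-- The element `n ⊗_B a`. -/
abbrev Induced.tmul (n : N) (a : A) : Induced ρA N :=
  BalancedTensor.tmul R ↥(coinvariantSubalgebra ρA) n a

/-- The bilinear map `(n, a) ↦ n ⊗_B a`. -/
def Induced.mk : N →ₗ[R] A →ₗ[R] Induced ρA N :=
  (TensorProduct.mk R N A).compr₂ (BalancedTensor.proj R ↥(coinvariantSubalgebra ρA) N A)

lemma Induced.mk_apply (n : N) (a : A) : Induced.mk ρA n a = Induced.tmul ρA n a := rfl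

lemma Induced.smul_tmul (n : N) (b : coinvariantSubalgebra ρA) (a : A) :
    Induced.tmul ρA (op b • n) a = Induced.tmul ρA n (b * a) :=
  BalancedTensor.smul_tmul _ _ n b a

/-- Right multiplication by `a` on `N ⊗_B A`. -/
def Induced.mulRight (a : A) : Induced ρA N →ₗ[R] Induced ρA N :=
  BalancedTensor.lift ((Induced.mk ρA).compl₂ (LinearMap.mulRight R a)) (by
    intro n b a'
    simp only [LinearMap.compl₂_apply, LinearMap.mulRight_apply, Induced.mk_apply,
      Induced.smul_tmul, Subalgebra.smul_def, smul_eq_mul, mul_assoc])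

lemma Induced.mulRight_tmul (a : A) (n : N) (a' : A) :
    Induced.mulRight ρA a (Induced.tmul ρA n a') = Induced.tmul ρA n (a' * a) :=
  BalancedTensor.lift_tmul _ _ n a'

lemma Induced.tmul_add (n : N) (a a' : A) :
    Induced.tmul ρA n (a + a') = Induced.tmul ρA n a + Induced.tmul ρA n a' :=
  (Induced.mk ρA n).map_add a a'

lemma Induced.tmul_smul (n : N) (r : R) (a : A) :
    Induced.tmul ρA n (r • a) = r • Induced.tmul ρA n a :=
  (Induced.mk ρA n).map_smul r a

/-- The right `A`-module structure `(n ⊗_B a') a = n ⊗_B a' a`. -/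
instance Induced.instModule : Module Aᵐᵒᵖ (Induced ρA N) :=
  Module.compHom _ (show Aᵐᵒᵖ →+* Module.End R (Induced ρA N) from
    { toFun := fun a => Induced.mulRight ρA (unop a)
      map_one' := BalancedTensor.hom_ext fun n p => by
        erw [Induced.mulRight_tmul]; simp
      map_mul' := fun a b => BalancedTensor.hom_ext fun n p => by
        rw [Module.End.mul_apply]
        change Induced.mulRight ρA _ (Induced.tmul ρA n p) =
          Induced.mulRight ρA _ (Induced.mulRight ρA _ (Induced.tmul ρA n p))
        rw [Induced.mulRight_tmul, Induced.mulRight_tmul, Induced.mulRight_tmul,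
          MulOpposite.unop_mul, mul_assoc]
      map_zero' := BalancedTensor.hom_ext fun n p => by
        erw [Induced.mulRight_tmul]
        rw [MulOpposite.unop_zero, mul_zero]
        exact (Induced.mk ρA n).map_zero
      map_add' := fun a b => BalancedTensor.hom_ext fun n p => by
        rw [LinearMap.add_apply]
        erw [Induced.mulRight_tmul, Induced.mulRight_tmul, Induced.mulRight_tmul]
        rw [MulOpposite.unop_add, mul_add, Induced.tmul_add] })

lemma Induced.op_smul_tmul (a : A) (n : N) (a' : A) :
    op a • Induced.tmul ρA n a' = Induced.tmul ρA n (a' * a) :=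
  Induced.mulRight_tmul ρA a n a'

instance Induced.instIsScalarTower : IsScalarTower R Aᵐᵒᵖ (Induced ρA N) where
  smul_assoc r a z := by
    have h : Induced.mulRight ρA (r • unop a) = r • Induced.mulRight (N := N) ρA (unop a) :=
      BalancedTensor.hom_ext fun n p => by
        rw [LinearMap.smul_apply]
        erw [Induced.mulRight_tmul, Induced.mulRight_tmul]
        rw [mul_smul_comm, Induced.tmul_smul]
    exact congrArg (fun f : Induced ρA N →ₗ[R] Induced ρA N => f z) h

/-- The coaction of `N ⊗_B A` as an `R`-linear map: `n ⊗_B a ↦ ∑ (n ⊗_B a₀) ⊗ a₁`. -/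
def Induced.coact : Induced ρA N →ₗ[R] Induced ρA N ⊗[R] C :=
  BalancedTensor.lift
    (LinearMap.mk₂ R (fun n a => (Induced.mk ρA n).rTensor C (ρA.ϱ a))
      (fun n n' a => by rw [map_add, LinearMap.rTensor_add, LinearMap.add_apply])
      (fun r n a => by rw [_root_.map_smul, LinearMap.rTensor_smul, LinearMap.smul_apply])
      (fun n a a' => by rw [map_add, map_add])
      (fun r n a => by rw [_root_.map_smul, _root_.map_smul])) (by
    intro n b a
    have h : Induced.mk ρA n ∘ₗ rightOrbit R (b : A) = Induced.mk ρA (op b • n) := by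
      ext a
      simp [Induced.mk_apply, Induced.smul_tmul]
    have hb : ρA.ϱ (b • a) = (rightOrbit R (b : A)).rTensor C (ρA.ϱ a) := by
      rw [← map_smul_of_coinvariant ρA ρA b.2, op_smul_eq_mul, Subalgebra.smul_def, smul_eq_mul]
    rw [LinearMap.mk₂_apply, LinearMap.mk₂_apply, hb, ← h, LinearMap.rTensor_comp_apply])

lemma Induced.coact_tmul (n : N) (a : A) :
    Induced.coact ρA (Induced.tmul ρA n a) = (Induced.mk ρA n).rTensor C (ρA.ϱ a) :=
  BalancedTensor.lift_tmul _ _ n a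

lemma Induced.coact_comp_mk (n : N) :
    Induced.coact ρA ∘ₗ Induced.mk ρA n = (Induced.mk ρA n).rTensor C ∘ₗ ρA.ϱ :=
  LinearMap.ext fun a => Induced.coact_tmul ρA n a

@[elab_as_elim]
lemma Induced.induction_on {p : Induced ρA N → Prop} (z : Induced ρA N) (h0 : p 0)
    (ht : ∀ n a, p (Induced.tmul ρA n a)) (ha : ∀ x y, p x → p y → p (x + y)) : p z := by
  obtain ⟨z, rfl⟩ := Submodule.mkQ_surjective _ z
  induction z with
  | zero => rw [map_zero]; exact h0
  | tmul n a => exact ht n a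
  | add x y hx hy => rw [map_add]; exact ha _ _ hx hy

lemma assoc_rTensor_rTensor {M M' : Type*} [AddCommGroup M] [Module R M] [AddCommGroup M']
    [Module R M'] (f : M →ₗ[R] M') (z : (M ⊗[R] C) ⊗[R] C) :
    TensorProduct.assoc R M' C C ((f.rTensor C).rTensor C z) =
      f.rTensor (C ⊗[R] C) (TensorProduct.assoc R M C C z) := by
  have h : (TensorProduct.assoc R M' C C).toLinearMap ∘ₗ (f.rTensor C).rTensor C =
      f.rTensor (C ⊗[R] C) ∘ₗ (TensorProduct.assoc R M C C).toLinearMap := by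
    ext; rfl
  exact LinearMap.congr_fun h z

lemma Induced.twistedAction_rTensor_mk (n : N) (a : A) (z : A ⊗[R] C) :
    twistedAction E.ψ a ((Induced.mk ρA n).rTensor C z) =
      (Induced.mk ρA n).rTensor C (twistedAction E.ψ a z) := by
  induction z with
  | zero => simp
  | add x y hx hy => simp only [map_add, hx, hy]
  | tmul b c =>
    have h : rightOrbit (A := A) R (Induced.mk ρA n b) =
        Induced.mk ρA n ∘ₗ rightOrbit (A := A) R b := by
      ext a
      simp only [rightOrbit_apply, Induced.mk_apply, Induced.op_smul_tmul, LinearMap.comp_apply,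
        op_smul_eq_mul]
    rw [LinearMap.rTensor_tmul, twistedAction_tmul, twistedAction_tmul, h,
      LinearMap.rTensor_comp_apply]

end Induced

/-- The entwined module `N ⊗_B A`, with coaction `n ⊗_B a ↦ ∑ (n ⊗_B a₀) ⊗ a₁`. -/
def inducedCoaction (N : Type*) [AddCommGroup N] [Module R N]
    [Module (↥(coinvariantSubalgebra ρA))ᵐᵒᵖ N] : E.EntwinedCoaction (Induced ρA N) where
  ϱ := Induced.coact ρA
  coassoc z := by
    refine Induced.induction_on ρA z (by simp) (fun n a => ?_)
      (fun x y hx hy => by simp only [map_add, hx, hy])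
    have h : ∀ y : A ⊗[R] C, (Induced.mk ρA n).rTensor (C ⊗[R] C) (Coalgebra.comul.lTensor A y) =
        Coalgebra.comul.lTensor _ ((Induced.mk ρA n).rTensor C y) := by
      intro y
      rw [← LinearMap.comp_apply, ← LinearMap.comp_apply, LinearMap.rTensor_comp_lTensor,
        LinearMap.lTensor_comp_rTensor]
    rw [Induced.coact_tmul, ← LinearMap.rTensor_comp_apply, Induced.coact_comp_mk,
      LinearMap.rTensor_comp_apply, assoc_rTensor_rTensor, ρA.coassoc, h]
  counit z := by
    refine Induced.induction_on ρA z (by simp) (fun n a => ?_)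
      (fun x y hx hy => by simp only [map_add, hx, hy])
    have h : ∀ y : A ⊗[R] R, TensorProduct.rid R _ ((Induced.mk ρA n).rTensor R y) =
        Induced.mk ρA n (TensorProduct.rid R A y) := by
      intro y
      induction y with
      | zero => simp
      | add x y hx hy => simp only [map_add, hx, hy]
      | tmul a r => simp
    rw [Induced.coact_tmul, ← LinearMap.comp_apply, LinearMap.lTensor_comp_rTensor,
      ← LinearMap.rTensor_comp_lTensor, LinearMap.comp_apply, h, ρA.counit, Induced.mk_apply]
  map_smul z a := by
    refine Induced.induction_on ρA z (by simp) (fun n a' => ?_)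
      (fun x y hx hy => by simp only [smul_add, map_add, hx, hy])
    rw [Induced.op_smul_tmul, Induced.coact_tmul, Induced.coact_tmul,
      Induced.twistedAction_rTensor_mk, ← ρA.map_smul, op_smul_eq_mul]

/-! ### The adjunction maps and the structure theorems -/

section Structure

/-- `Ψ_M : M^{co} ⊗_B A → M`, `m ⊗_B a ↦ m a`. -/
def Psi {M : Type*} [AddCommGroup M] [Module R M] [Module Aᵐᵒᵖ M] [IsScalarTower R Aᵐᵒᵖ M]
    (ρM : E.EntwinedCoaction M) : Induced ρA ↥(coinvariants ρA ρM) →ₗ[R] M :=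
  BalancedTensor.lift
    (LinearMap.mk₂ R (fun (m : ↥(coinvariants ρA ρM)) (a : A) => op a • (m : M))
      (fun m m' a => smul_add _ _ _) (fun r m a => smul_comm _ _ _)
      (fun m a a' => by rw [MulOpposite.op_add, add_smul])
      (fun r m a => by rw [MulOpposite.op_smul, smul_assoc])) (by
    intro m b a
    change op a • (op (b : A) • (m : M)) = op ((b : A) * a) • (m : M)
    rw [MulOpposite.op_mul, mul_smul])

/-- `Φ_N : N → (N ⊗_B A)^{co}`, `n ↦ n ⊗_B 1`. -/
def Phi (N : Type*) [AddCommGroup N] [Module R N] [Module (↥(coinvariantSubalgebra ρA))ᵐᵒᵖ N] :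
    N →ₗ[(↥(coinvariantSubalgebra ρA))ᵐᵒᵖ] ↥(coinvariants ρA (inducedCoaction ρA N)) where
  toFun n := ⟨Induced.tmul ρA n 1, by
    have h : rightOrbit R (Induced.tmul ρA n 1) = Induced.mk ρA n := by
      ext a
      rw [rightOrbit_apply, Induced.op_smul_tmul, one_mul, Induced.mk_apply]
    change Induced.coact ρA _ = _
    rw [Induced.coact_tmul, h]⟩
  map_add' n n' := Subtype.ext (congrArg (fun f : A →ₗ[R] _ => f 1) ((Induced.mk ρA).map_add n n'))
  map_smul' b n := by
    refine Subtype.ext ?_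
    change Induced.tmul ρA (op (unop b) • n) 1 = op ((unop b : _) : A) • Induced.tmul ρA n 1
    rw [Induced.smul_tmul, Induced.op_smul_tmul, mul_one, one_mul]

/-- The weak structure theorem: `Ψ_M` is an isomorphism for every entwined module `M`. -/
def WeakStructureTheorem : Prop :=
  ∀ (M : Type t) [AddCommGroup M] [Module R M] [Module Aᵐᵒᵖ M] [IsScalarTower R Aᵐᵒᵖ M]
    (ρM : E.EntwinedCoaction M), Function.Bijective (Psi ρA ρM)

/-- The strong structure theorem: the weak one holds, and `Φ_N` is an isomorphism for every right
`B`-module `N`. The `R`-module structure of `N` is the one induced by `R → B`. -/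
def StrongStructureTheorem : Prop :=
  WeakStructureTheorem.{u, v, w, t} ρA ∧
    ∀ (N : Type t) [AddCommGroup N] [Module R N] [Module (↥(coinvariantSubalgebra ρA))ᵐᵒᵖ N]
      [IsScalarTower R (↥(coinvariantSubalgebra ρA))ᵐᵒᵖ N], Function.Bijective (Phi ρA N)

end Structure

/-! ### Galois extensions, normal bases, cleft extensions -/

/-- `β : A ⊗_B A → A ⊗_R C`, `a' ⊗_B a ↦ a' (∑ 1₀ ⊗ 1₁) a = ∑ a' 1₀ a_ψ ⊗ 1₁^ψ`. -/
def galoisMap : Induced ρA A →ₗ[R] A ⊗[R] C :=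
  BalancedTensor.lift
    (LinearMap.mk₂ R
      (fun a' a => twistedAction E.ψ a ((rightOrbit R a').rTensor C (ρA.ϱ 1)))
      (fun m m' a => by rw [map_add, LinearMap.rTensor_add, LinearMap.add_apply, map_add])
      (fun r m a => by
        rw [_root_.map_smul, LinearMap.rTensor_smul, LinearMap.smul_apply, _root_.map_smul])
      (fun m a a' => by
        rw [rTensor_rightOrbit_smul, rTensor_rightOrbit_smul, rTensor_rightOrbit_smul,
          ← ρA.rho_eq, ← ρA.rho_eq, ← ρA.rho_eq, map_add, map_add])
      (fun r m a => by
        rw [rTensor_rightOrbit_smul, rTensor_rightOrbit_smul, ← ρA.rho_eq, ← ρA.rho_eq,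
          _root_.map_smul, _root_.map_smul])) (by
    intro a' b a
    rw [LinearMap.mk₂_apply, LinearMap.mk₂_apply, rTensor_rightOrbit_smul,
      rTensor_rightOrbit_smul, ← ρA.rho_eq, ← ρA.rho_eq, Subalgebra.smul_def, smul_eq_mul,
      ← op_smul_eq_mul a (b : A), map_smul_of_coinvariant ρA ρA b.2,
      ← LinearMap.rTensor_comp_apply, rightOrbit_comp, Subalgebra.rightModule_smul])

/-- `A / B` is Galois for the coring `A ⊗_R C`. -/
def IsGalois : Prop := Function.Bijective (galoisMap ρA)

/-- `B ⊗_R C` is a right `C`-comodule via `id ⊗ Δ`; the right normal basis property asks for a left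
`B`-linear, right `C`-colinear isomorphism `A ≃ B ⊗_R C`. -/
def HasRightNormalBasis : Prop :=
  ∃ θ : A ≃ₗ[↥(coinvariantSubalgebra ρA)] (↥(coinvariantSubalgebra ρA) ⊗[R] C),
    ∀ a : A,
      (Coalgebra.comul (R := R) (A := C)).lTensor ↥(coinvariantSubalgebra ρA) (θ a) =
        TensorProduct.assoc R ↥(coinvariantSubalgebra ρA) C C
          ((θ.toLinearMap.restrictScalars R).rTensor C (ρA.ϱ a))

/-- An integral: a right `C`-colinear map `λ : C → A`. -/
def IsIntegral (l : C →ₗ[R] A) : Prop :=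
  ∀ c : C, ρA.ϱ (l c) = l.rTensor C (Coalgebra.comul c)

/-- `A / B` is cleft: there is an integral invertible for the convolution product on
`Hom_R (C, A)`. -/
def IsCleft : Prop :=
  ∃ l : C →ₗ[R] A, IsIntegral ρA l ∧ IsUnit (WithConv.toConv l)

/-! ### The ring `#_ψ^{op} (C, A)` and the map `Λ` -/

section Smash

variable (E) in
/-- The `R`-module `Hom_R (C, A)`, underlying the ring `#_ψ^{op} (C, A)`. -/
def Smash : Type _ := (fun _ : EntwiningStructure R A C => C →ₗ[R] A) E

/-- The map `a ⊗ c ↦ a f (c)`. -/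
def evalMul (f : C →ₗ[R] A) : A ⊗[R] C →ₗ[R] A := LinearMap.mul' R A ∘ₗ f.lTensor A

lemma evalMul_tmul (f : C →ₗ[R] A) (a : A) (c : C) :
    evalMul f (a ⊗ₜ[R] c) = a * f c := rfl

namespace Smash

variable (E) in
/-- The map `c ↦ ∑ f (c₂)_ψ ⊗ c₁^ψ`. -/
def aux (f : C →ₗ[R] A) : C →ₗ[R] A ⊗[R] C :=
  E.ψ ∘ₗ f.lTensor C ∘ₗ Coalgebra.comul

variable (E) in
/-- The product `(f · g) (c) = ∑ f (c₂)_ψ g (c₁^ψ)`. -/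
def mulMap (f g : C →ₗ[R] A) : C →ₗ[R] A := evalMul g ∘ₗ aux E f

variable (E) in
/-- The map `a ⊗ (c ⊗ d) ↦ a ψ (c ⊗ g (d))`. -/
def leftAux (g : C →ₗ[R] A) : A ⊗[R] (C ⊗[R] C) →ₗ[R] A ⊗[R] C :=
  (LinearMap.mul' R A).rTensor C ∘ₗ (TensorProduct.assoc R A A C).symm.toLinearMap ∘ₗ
    (E.ψ ∘ₗ g.lTensor C).lTensor A

lemma psi_evalMul (g : C →ₗ[R] A) (z : (C ⊗[R] A) ⊗[R] C) :
    E.ψ ((evalMul g).lTensor C (TensorProduct.assoc R C A C z)) =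
      leftAux E g (TensorProduct.assoc R A C C (E.ψ.rTensor C z)) := by
  induction z with
  | zero => simp
  | add x y hx hy => simp only [map_add, hx, hy]
  | tmul x d =>
    induction x with
    | zero => simp
    | add x y hx hy => simp only [TensorProduct.add_tmul, map_add, hx, hy]
    | tmul c a =>
      rw [TensorProduct.assoc_tmul, LinearMap.lTensor_tmul, evalMul_tmul, E.map_mul,
        LinearMap.rTensor_tmul]
      generalize E.ψ (c ⊗ₜ[R] a) = y
      induction y with
      | zero => simp
      | add x y hx hy => simp only [TensorProduct.add_tmul, map_add, hx, hy]
      | tmul b e =>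
        rw [twistedAction_tmul, TensorProduct.assoc_tmul, leftAux, LinearMap.comp_apply,
          LinearMap.comp_apply, LinearMap.lTensor_tmul, LinearMap.comp_apply,
          LinearMap.lTensor_tmul]
        generalize E.ψ (e ⊗ₜ[R] g d) = y
        induction y with
        | zero => simp
        | add x y hx hy => simp only [TensorProduct.tmul_add, map_add, hx, hy]
        | tmul a' c' => simp

lemma aux_mulMap (f g : C →ₗ[R] A) (c : C) :
    aux E (mulMap E f g) c = leftAux E g (Coalgebra.comul.lTensor A (aux E f c)) := by
  have h1 : ∀ z : C ⊗[R] C,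
      E.ψ ((mulMap E f g).lTensor C z) = E.ψ ((evalMul g).lTensor C (E.ψ.lTensor C
        ((f.lTensor C).lTensor C (Coalgebra.comul.lTensor C z)))) := by
    intro z
    rw [mulMap, aux, LinearMap.lTensor_comp_apply, LinearMap.lTensor_comp_apply,
      LinearMap.lTensor_comp_apply]
  have h2 : ∀ z : C ⊗[R] C,
      E.ψ ((evalMul g).lTensor C (E.ψ.lTensor C ((f.lTensor C).lTensor C
        (TensorProduct.assoc R C C C (Coalgebra.comul.rTensor C z))))) =
        leftAux E g (Coalgebra.comul.lTensor A (E.ψ (f.lTensor C z))) := by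
    intro z
    induction z with
    | zero => simp
    | add x y hx hy => simp only [map_add, hx, hy]
    | tmul x y =>
      rw [LinearMap.lTensor_tmul, E.map_comul, ← psi_evalMul, LinearEquiv.apply_symm_apply,
        LinearMap.rTensor_tmul]
      congr 3
      generalize (Coalgebra.comul x : C ⊗[R] C) = w
      induction w with
      | zero => simp
      | add x y hx hy => simp only [TensorProduct.add_tmul, map_add, hx, hy]
      | tmul a b => simp
  rw [aux, LinearMap.comp_apply, LinearMap.comp_apply, h1, ← Coalgebra.coassoc_apply, h2]
  rfl

lemma mulMap_assoc (f g h : C →ₗ[R] A) :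
    mulMap E (mulMap E f g) h = mulMap E f (mulMap E g h) := by
  have key : ∀ z : A ⊗[R] C, evalMul h (leftAux E g (Coalgebra.comul.lTensor A z)) =
      evalMul (mulMap E g h) z := by
    intro z
    induction z with
    | zero => simp
    | add x y hx hy => simp only [map_add, hx, hy]
    | tmul a c =>
      rw [evalMul_tmul, mulMap, LinearMap.comp_apply, leftAux, LinearMap.comp_apply,
        LinearMap.comp_apply, LinearMap.lTensor_tmul, LinearMap.lTensor_tmul]
      change _ = a * evalMul h ((E.ψ ∘ₗ g.lTensor C) (Coalgebra.comul c))
      generalize (E.ψ ∘ₗ g.lTensor C) (Coalgebra.comul c) = y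
      induction y with
      | zero => simp
      | add x y hx hy => simp only [TensorProduct.tmul_add, map_add, mul_add, hx, hy]
      | tmul a' c' => simp [evalMul_tmul, mul_assoc]
  ext c
  rw [mulMap, LinearMap.comp_apply, aux_mulMap, key]
  rfl

lemma evalMul_unit (z : A ⊗[R] C) :
    evalMul (Algebra.linearMap R A ∘ₗ Coalgebra.counit) z =
      TensorProduct.rid R A (Coalgebra.counit.lTensor A z) := by
  induction z with
  | zero => simp
  | add x y hx hy => simp only [map_add, hx, hy]
  | tmul a c => simp [evalMul_tmul, Algebra.smul_def, Algebra.commutes]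

lemma mulMap_one (f : C →ₗ[R] A) :
    mulMap E f (Algebra.linearMap R A ∘ₗ Coalgebra.counit) = f := by
  have key : ∀ z : C ⊗[R] C, TensorProduct.rid R A (Coalgebra.counit.lTensor A
      (E.ψ (f.lTensor C z))) = f (TensorProduct.lid R C (Coalgebra.counit.rTensor C z)) := by
    intro z
    induction z with
    | zero => simp
    | add x y hx hy => simp only [map_add, hx, hy]
    | tmul x y => simp [E.map_counit]
  ext c
  rw [mulMap, LinearMap.comp_apply, evalMul_unit, aux, LinearMap.comp_apply,
    LinearMap.comp_apply, key, Coalgebra.rTensor_counit_comul]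
  simp

lemma one_mulMap (f : C →ₗ[R] A) :
    mulMap E (Algebra.linearMap R A ∘ₗ Coalgebra.counit) f = f := by
  have key : ∀ z : C ⊗[R] C, evalMul f (E.ψ
      ((Algebra.linearMap R A ∘ₗ Coalgebra.counit).lTensor C z)) =
        f (TensorProduct.rid R C (Coalgebra.counit.lTensor C z)) := by
    intro z
    induction z with
    | zero => simp
    | add x y hx hy => simp only [map_add, hx, hy]
    | tmul x y =>
      simp [Algebra.algebraMap_eq_smul_one, TensorProduct.tmul_smul, E.map_one, evalMul_tmul]
  ext c
  rw [mulMap, LinearMap.comp_apply, aux, LinearMap.comp_apply,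
    LinearMap.comp_apply, key, Coalgebra.lTensor_counit_comul]
  simp

lemma mulMap_add (f g h : C →ₗ[R] A) : mulMap E f (g + h) = mulMap E f g + mulMap E f h := by
  simp [mulMap, evalMul, LinearMap.lTensor_add, LinearMap.comp_add, LinearMap.add_comp]

lemma add_mulMap (f g h : C →ₗ[R] A) : mulMap E (f + g) h = mulMap E f h + mulMap E g h := by
  simp [mulMap, aux, LinearMap.lTensor_add, LinearMap.comp_add, LinearMap.add_comp]

instance : AddCommGroup E.Smash := inferInstanceAs (AddCommGroup (C →ₗ[R] A))

/-- The ring `#_ψ^{op} (C, A)`, with product `(f · g) (c) = ∑ f (c₂)_ψ g (c₁^ψ)` and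
unit `c ↦ ε (c) 1`. -/
instance : Ring E.Smash :=
  { (inferInstance : AddCommGroup E.Smash) with
    mul := fun f g => mulMap E f g
    one := Algebra.linearMap R A ∘ₗ Coalgebra.counit
    left_distrib := mulMap_add
    right_distrib := add_mulMap
    zero_mul := fun f => by
      change mulMap E 0 f = 0
      simp [mulMap, aux]
    mul_zero := fun f => by
      change mulMap E f 0 = 0
      simp [mulMap, evalMul]
    mul_assoc := mulMap_assoc
    one_mul := one_mulMap
    mul_one := mulMap_one }

/-- An element of `#_ψ^{op} (C, A)` as a linear map `C → A`. -/
def toLinearMap (f : E.Smash) : C →ₗ[R] A := f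

end Smash

/-- The map `Λ : #_ψ^{op} (C, A) → End (_B A)^{op}`, `g ↦ [a ↦ a ↼ g]`, where
`a ↼ g = ∑ a₀ g (a₁)`. -/
def Lam (g : E.Smash) : (Module.End ↥(coinvariantSubalgebra ρA) A)ᵐᵒᵖ :=
  op
    { toFun := fun a => evalMul g.toLinearMap (ρA.ϱ a)
      map_add' := fun a a' => by rw [map_add, map_add]
      map_smul' := fun b a => by
        have hb : ρA.ϱ (b • a) = (rightOrbit R (b : A)).rTensor C (ρA.ϱ a) := by
          rw [← map_smul_of_coinvariant ρA ρA b.2, op_smul_eq_mul, Subalgebra.smul_def,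
            smul_eq_mul]
        rw [hb, RingHom.id_apply]
        generalize ρA.ϱ a = z
        induction z with
        | zero => simp
        | add x y hx hy => simp only [map_add, smul_add, hx, hy]
        | tmul a c => simp [evalMul_tmul, Subalgebra.smul_def, mul_assoc] }

/-- `Λ` is an isomorphism of rings. -/
def LamIsRingIso : Prop :=
  ∃ e : E.Smash ≃+* (Module.End ↥(coinvariantSubalgebra ρA) A)ᵐᵒᵖ, ∀ g, e g = Lam ρA g

end Smash

end EntwiningStructure

/-! Write T_f(m) = ∑ m₀ f(m₁) for the operator `twist f` attached to a map f : C → A. Two identities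
carry the proof: ∑ T_f(m₀) g(m₁) = T_{f⋆g}(m) (`orbitEval_rTensor_twist`), and T_f(λ(c)) = (λ⋆f)(c)
for an integral λ (`IsIntegral.twist_apply`).

Let λ be an integral with convolution inverse f. Since ϱ(1) = 1 ⊗ x, cancelling λ in ϱ(T_f(λ(c))) =
ε(c) 1 ⊗ x gives ∑ f(c₂)_ψ ⊗ c₁^ψ = f(c) ⊗ x, so T_f maps every entwined module into its
coinvariants (`IsIntegral.twist_inverse_mem`). All inverses are then explicit: with p = T_f on A,
the normal basis is a ↦ ∑ p(a₀) ⊗ a₁; the inverse of Ψ_M is m ↦ ∑ T_f(m₀) ⊗_B λ(m₁); the inverse of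
Φ_N is induced by n ⊗_B a ↦ n p(a) λ(x); the preimage of φ under Λ is f ⋆ (φ ∘ λ).

Conversely, a normal basis amounts to a pair (λ, p) as in `IsNormalPair`, and what is missing for
cleftness is an f with T_f = p. Surjectivity of Λ provides it directly. In the Galois case f is read
off from the left A-linear map that β transports from a ⊗_B a' ↦ a p(a'). The weak structure theorem
gives the Galois property because, on the entwined module A ⊗ C with coinvariants A ⊗ x, the map Ψ
is β. -/

namespace EntwiningStructure

variable {R : Type u} [CommRing R] {A : Type v} [Ring A] [Algebra R A]
  {C : Type w} [AddCommGroup C] [Module R C]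

/-! ### Evaluating a map `C → A` on `M ⊗ C` -/

section OrbitEval

variable {M : Type*} [AddCommGroup M] [Module R M] [Module Aᵐᵒᵖ M] [IsScalarTower R Aᵐᵒᵖ M]

/-- The map `m ⊗ c ↦ m f (c)`. -/
def orbitEval (M : Type*) [AddCommGroup M] [Module R M] [Module Aᵐᵒᵖ M] [IsScalarTower R Aᵐᵒᵖ M]
    (f : C →ₗ[R] A) : M ⊗[R] C →ₗ[R] M :=
  TensorProduct.lift ((rightOrbit R).compl₂ f)

@[simp] lemma orbitEval_tmul (f : C →ₗ[R] A) (m : M) (c : C) :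
    orbitEval M f (m ⊗ₜ[R] c) = op (f c) • m := rfl

lemma orbitEval_self (f : C →ₗ[R] A) : orbitEval A f = evalMul f :=
  TensorProduct.ext' fun _ _ => rfl

lemma orbitEval_rTensor_rightOrbit (f : C →ₗ[R] A) (m : M) (z : A ⊗[R] C) :
    orbitEval M f ((rightOrbit R m).rTensor C z) = op (evalMul f z) • m := by
  induction z with
  | zero => simp
  | add x y hx hy => simp only [map_add, MulOpposite.op_add, add_smul, hx, hy]
  | tmul a c =>
    simp [evalMul, mul_smul]

lemma evalMul_rTensor_rightOrbit (f : C →ₗ[R] A) (a : A) (z : A ⊗[R] C) :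
    evalMul f ((rightOrbit R a).rTensor C z) = a * evalMul f z := by
  rw [← orbitEval_self, orbitEval_rTensor_rightOrbit, orbitEval_self, op_smul_eq_mul]

/-- The map `m ⊗ c ↦ m h (c)`, for `h : C → A ⊗ C`. -/
def orbitMap (M : Type*) [AddCommGroup M] [Module R M] [Module Aᵐᵒᵖ M] [IsScalarTower R Aᵐᵒᵖ M]
    (h : C →ₗ[R] A ⊗[R] C) : M ⊗[R] C →ₗ[R] M ⊗[R] C :=
  TensorProduct.lift (LinearMap.mk₂ R (fun m c => (rightOrbit R m).rTensor C (h c))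
    (fun m m' c => by rw [map_add, LinearMap.rTensor_add, LinearMap.add_apply])
    (fun r m c => by rw [map_smul, LinearMap.rTensor_smul, LinearMap.smul_apply])
    (fun m c c' => by rw [map_add, map_add])
    (fun r m c => by rw [map_smul, map_smul]))

@[simp] lemma orbitMap_tmul (h : C →ₗ[R] A ⊗[R] C) (m : M) (c : C) :
    orbitMap M h (m ⊗ₜ[R] c) = (rightOrbit R m).rTensor C (h c) := rfl

lemma rTensor_rightOrbit_comp (m : M) (a : A) (z : A ⊗[R] C) :
    (rightOrbit R (op a • m)).rTensor C z =
      (rightOrbit R m).rTensor C ((rightOrbit R a).rTensor C z) := by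
  have h : rightOrbit (A := A) R (op a • m) = rightOrbit R m ∘ₗ rightOrbit R a := by
    ext b
    simp [mul_smul]
  rw [h, LinearMap.rTensor_comp_apply]

lemma rTensor_rightOrbit_one (z : A ⊗[R] C) : (rightOrbit R (1 : A)).rTensor C z = z := by
  have h : rightOrbit R (1 : A) = LinearMap.id := by ext; simp
  rw [h, LinearMap.rTensor_id, LinearMap.id_apply]

end OrbitEval

variable [Coalgebra R C]

/-! ### Convolution, acting on A-valued and on (A ⊗ C)-valued maps. -/

section Convolution

/-- The convolution product `(f ⋆ g) (c) = ∑ f (c₁) g (c₂)`. -/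
def conv (f g : C →ₗ[R] A) : C →ₗ[R] A := evalMul g ∘ₗ f.rTensor C ∘ₗ Coalgebra.comul

lemma conv_apply (f g : C →ₗ[R] A) (c : C) :
    conv f g c = evalMul g (f.rTensor C (Coalgebra.comul c)) := rfl

/-- Identifies `conv` with the product of the ring `WithConv (C →ₗ[R] A)`, so that associativity can
be taken from there. -/
lemma ofConv_mul (f g : WithConv (C →ₗ[R] A)) :
    (f * g).ofConv = conv f.ofConv g.ofConv := by
  ext c
  rw [conv_apply]
  change LinearMap.mul' R A (TensorProduct.map f.ofConv g.ofConv (Coalgebra.comul c)) = _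
  rw [← LinearMap.lTensor_comp_rTensor]
  rfl

variable (R A C) in
/-- The unit `c ↦ ε (c) 1` of the convolution product. -/
def convUnit : C →ₗ[R] A := Algebra.linearMap R A ∘ₗ Coalgebra.counit

lemma convUnit_apply (c : C) :
    convUnit R A C c = (Coalgebra.counit c : R) • (1 : A) :=
  Algebra.algebraMap_eq_smul_one _

lemma isUnit_toConv_iff (f : C →ₗ[R] A) :
    IsUnit (WithConv.toConv f) ↔
      ∃ g : C →ₗ[R] A, conv f g = convUnit R A C ∧ conv g f = convUnit R A C := by
  rw [isUnit_iff_exists]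
  constructor
  · rintro ⟨g, h1, h2⟩
    refine ⟨g.ofConv, ?_, ?_⟩
    · exact (ofConv_mul _ g).symm.trans (congrArg WithConv.ofConv h1)
    · exact (ofConv_mul g _).symm.trans (congrArg WithConv.ofConv h2)
  · rintro ⟨g, h1, h2⟩
    refine ⟨WithConv.toConv g, ?_, ?_⟩
    · exact congrArg WithConv.toConv ((ofConv_mul _ _).trans h1)
    · exact congrArg WithConv.toConv ((ofConv_mul _ _).trans h2)

variable {M : Type*} [AddCommGroup M] [Module R M] [Module Aᵐᵒᵖ M] [IsScalarTower R Aᵐᵒᵖ M]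

/-- The hypothesis on `z` and `y` is the shape of coassociativity: it holds for `y = ϱ m` and `z =
(ϱ ⊗ id) (ϱ m)`. -/
lemma orbitEval_conv (f g : C →ₗ[R] A) (z : (M ⊗[R] C) ⊗[R] C) (y : M ⊗[R] C)
    (h : TensorProduct.assoc R M C C z = Coalgebra.comul.lTensor M y) :
    orbitEval M g ((orbitEval M f).rTensor C z) = orbitEval M (conv f g) y := by
  have h1 : ∀ y : M ⊗[R] C, orbitEval M g ((orbitEval M f).rTensor C
      ((TensorProduct.assoc R M C C).symm (Coalgebra.comul.lTensor M y))) =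
        orbitEval M (conv f g) y := by
    intro y
    induction y with
    | zero => simp
    | add x y hx hy => simp only [map_add, hx, hy]
    | tmul m c =>
      rw [LinearMap.lTensor_tmul, orbitEval_tmul, conv_apply]
      generalize (Coalgebra.comul c : C ⊗[R] C) = w
      induction w with
      | zero => simp
      | add x y hx hy =>
        simp only [TensorProduct.tmul_add, map_add, hx, hy, MulOpposite.op_add, add_smul]
      | tmul c d => simp [evalMul, mul_smul]
  rw [← h1, ← h, LinearEquiv.symm_apply_apply]

lemma orbitEval_convUnit (z : M ⊗[R] C) : orbitEval M (convUnit R A C) z =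
    TensorProduct.rid R M (Coalgebra.counit.lTensor M z) := by
  induction z with
  | zero => simp
  | add x y hx hy => simp only [map_add, hx, hy]
  | tmul m c => simp [convUnit_apply, MulOpposite.op_smul]

/-- The expression `orbitMap A h (f.rTensor C (comul c))` is the convolution ∑ f(c₁) h(c₂) of f with
an (A ⊗ C)-valued map h. Here h(c) = ε(c) y, and the counit collapses the sum. -/
lemma orbitMap_convUnit (y : A ⊗[R] C) (f : C →ₗ[R] A) (c : C) :
    orbitMap A ((LinearMap.toSpanSingleton R _ y) ∘ₗ Coalgebra.counit)
      (f.rTensor C (Coalgebra.comul c)) = (rightOrbit R (f c)).rTensor C y := by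
  have h : ∀ z : C ⊗[R] C, orbitMap A ((LinearMap.toSpanSingleton R _ y) ∘ₗ Coalgebra.counit)
      (f.rTensor C z) = (rightOrbit R (f (TensorProduct.rid R C
        (Coalgebra.counit.lTensor C z)))).rTensor C y := by
    intro z
    induction z with
    | zero => simp
    | add x y hx hy => simp only [map_add, hx, hy, LinearMap.rTensor_add, LinearMap.add_apply]
    | tmul c d => simp [LinearMap.rTensor_smul]
  rw [h, Coalgebra.lTensor_counit_comul, TensorProduct.rid_tmul, one_smul]

/-- Associativity f ⋆ (g ⋆ h) = (f ⋆ g) ⋆ h for h with values in A ⊗ C. It is what allows a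
convolution invertible map to be cancelled from such identities. -/
lemma orbitMap_conv (f g : C →ₗ[R] A) (h k : C →ₗ[R] A ⊗[R] C)
    (hk : ∀ c, k c = orbitMap A h (g.rTensor C (Coalgebra.comul c))) (c : C) :
    orbitMap A k (f.rTensor C (Coalgebra.comul c)) =
      orbitMap A h ((conv f g).rTensor C (Coalgebra.comul c)) := by
  have h1 : ∀ z : C ⊗[R] C, orbitMap A k (f.rTensor C z) = orbitMap A h
      ((evalMul g).rTensor C ((f.rTensor C).rTensor C
        ((TensorProduct.assoc R C C C).symm (Coalgebra.comul.lTensor C z)))) := by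
    intro z
    induction z with
    | zero => simp
    | add x y hx hy => simp only [map_add, hx, hy]
    | tmul c d =>
      rw [LinearMap.rTensor_tmul, orbitMap_tmul, hk, LinearMap.lTensor_tmul]
      generalize (Coalgebra.comul d : C ⊗[R] C) = w
      induction w with
      | zero => simp
      | add x y hx hy => simp only [TensorProduct.tmul_add, map_add, hx, hy]
      | tmul d e =>
        rw [LinearMap.rTensor_tmul, orbitMap_tmul, ← rTensor_rightOrbit_comp]
        simp [evalMul]
  rw [h1, ← Coalgebra.coassoc_apply, LinearEquiv.symm_apply_apply, ← LinearMap.rTensor_comp_apply,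
    ← LinearMap.rTensor_comp_apply]
  rfl

lemma orbitMap_convUnit_left (h : C →ₗ[R] A ⊗[R] C) (c : C) :
    orbitMap A h ((convUnit R A C).rTensor C (Coalgebra.comul c)) = h c := by
  have h1 : ∀ z : C ⊗[R] C, orbitMap A h ((convUnit R A C).rTensor C z) =
      h (TensorProduct.lid R C (Coalgebra.counit.rTensor C z)) := by
    intro z
    induction z with
    | zero => simp
    | add x y hx hy => simp only [map_add, hx, hy]
    | tmul c d => simp [convUnit_apply, LinearMap.rTensor_smul, rTensor_rightOrbit_one]
  rw [h1, Coalgebra.rTensor_counit_comul, TensorProduct.lid_tmul, one_smul]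

/-- Convolution with a map `f` having a left inverse is injective. -/
lemma orbitMap_injective {f g : C →ₗ[R] A} (hgf : conv g f = convUnit R A C)
    {h k : C →ₗ[R] A ⊗[R] C}
    (hk : ∀ c, orbitMap A h (f.rTensor C (Coalgebra.comul c)) = k c) (c : C) :
    h c = orbitMap A k (g.rTensor C (Coalgebra.comul c)) := by
  rw [orbitMap_conv g f h k (fun c => (hk c).symm), hgf, orbitMap_convUnit_left]

end Convolution

/-! ### Entwined modules -/

variable {E : EntwiningStructure R A C} (ρA : E.EntwinedCoaction A)

namespace EntwinedCoaction

variable {M : Type*} [AddCommGroup M] [Module R M] [Module Aᵐᵒᵖ M] [IsScalarTower R Aᵐᵒᵖ M]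
  (ρM : E.EntwinedCoaction M)

/-- The map `m ↦ ∑ m₀ f (m₁)`. -/
def twist (f : C →ₗ[R] A) : M →ₗ[R] M := orbitEval M f ∘ₗ ρM.ϱ

lemma twist_apply (f : C →ₗ[R] A) (m : M) : ρM.twist f m = orbitEval M f (ρM.ϱ m) := rfl

lemma twist_convUnit (m : M) : ρM.twist (convUnit R A C) m = m := by
  rw [twist_apply, orbitEval_convUnit, ρM.counit]

/-- By coassociativity both sides are ∑ m₀ f(m₁) g(m₂). When f ⋆ g is the unit, the result is m
itself; most inverse checks below reduce to this. -/
lemma orbitEval_rTensor_twist (f g : C →ₗ[R] A) (m : M) :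
    orbitEval M g ((ρM.twist f).rTensor C (ρM.ϱ m)) = ρM.twist (conv f g) m := by
  rw [twist, LinearMap.rTensor_comp_apply, twist_apply]
  exact orbitEval_conv f g _ _ (ρM.coassoc m)

/-- `∑ (m₀ f (m₁))₀ ⊗ (m₀ f (m₁))₁ = ∑ m₀ f (m₂)_ψ ⊗ m₁^ψ` -/
lemma rho_twist (f : C →ₗ[R] A) (m : M) :
    ρM.ϱ (ρM.twist f m) = orbitMap M (Smash.aux E f) (ρM.ϱ m) := by
  -- The entwining axiom `map_smul`, made linear in m ⊗ c: ϱ(m f(c)) is f(c) acting on ϱ(m).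
  have h1 : ∀ z : M ⊗[R] C, ρM.ϱ (orbitEval M f z) = TensorProduct.lift
      (LinearMap.mk₂ R (fun w c => twistedAction E.ψ (f c) w) (fun _ _ _ => map_add _ _ _)
        (fun _ _ _ => LinearMap.map_smul _ _ _)
        (fun w c d => by
          rw [map_add]
          induction w with
          | zero => simp
          | add x y hx hy => simp only [map_add, hx, hy]; abel
          | tmul m c => simp [TensorProduct.tmul_add])
        (fun r w c => by
          rw [LinearMap.map_smul]
          induction w with
          | zero => simp
          | add x y hx hy => simp only [map_add, hx, hy, smul_add]
          | tmul m c => simp)) (ρM.ϱ.rTensor C z) := by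
    intro z
    induction z with
    | zero => simp
    | add x y hx hy => simp only [map_add, hx, hy]
    | tmul m c => simp [ρM.map_smul]
  -- Coassociativity replaces (ϱ ⊗ id) ϱ(m) by ∑ m₀ ⊗ Δ(m₁); afterwards the identity is linear in
  -- ϱ(m) and can be checked on pure tensors.
  rw [twist_apply, h1, ← (TensorProduct.assoc R M C C).symm_apply_apply (ρM.ϱ.rTensor C (ρM.ϱ m)),
    ρM.coassoc]
  generalize ρM.ϱ m = z
  induction z with
  | zero => simp
  | add x y hx hy => simp only [map_add, hx, hy]
  | tmul m c =>
    rw [LinearMap.lTensor_tmul, orbitMap_tmul, Smash.aux, LinearMap.comp_apply,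
      LinearMap.comp_apply]
    generalize (Coalgebra.comul c : C ⊗[R] C) = w
    induction w with
    | zero => simp
    | add x y hx hy => simp only [TensorProduct.tmul_add, map_add, hx, hy]
    | tmul d e => simp

end EntwinedCoaction

/-! ### Coinvariants -/

section Coinvariants

variable {M : Type*} [AddCommGroup M] [Module R M] [Module Aᵐᵒᵖ M] [IsScalarTower R Aᵐᵒᵖ M]
  (ρM : E.EntwinedCoaction M)

lemma rho_one {x : C} (hρ : ∀ a : A, ρA.ϱ a = E.ψ (x ⊗ₜ[R] a)) : ρA.ϱ 1 = 1 ⊗ₜ[R] x := by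
  rw [hρ, E.map_one]

lemma rho_coinvariantSubalgebra_smul (b : coinvariantSubalgebra ρA) (a : A) :
    ρA.ϱ (b • a) = (rightOrbit R (b : A)).rTensor C (ρA.ϱ a) :=
  map_smul_of_coinvariant ρA ρA b.2 a

lemma mem_coinvariants_iff {x : C} (h1 : ρA.ϱ 1 = 1 ⊗ₜ[R] x) (m : M) :
    m ∈ coinvariants ρA ρM ↔ ρM.ϱ m = m ⊗ₜ[R] x := by
  change ρM.ϱ m = (rightOrbit R m).rTensor C (ρA.ϱ 1) ↔ _
  rw [h1, LinearMap.rTensor_tmul, rightOrbit_apply, MulOpposite.op_one, one_smul]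

/-- For coinvariant m one has ϱ(ma) = m ϱ(a), so twisting only affects the factor a. The case M = A
is the left B-linearity of `twist f`. -/
lemma twist_smul_of_coinvariant (f : C →ₗ[R] A) {m : M} (hm : m ∈ coinvariants ρA ρM) (a : A) :
    ρM.twist f (op a • m) = op (ρA.twist f a) • m := by
  rw [EntwinedCoaction.twist_apply, map_smul_of_coinvariant ρA ρM hm,
    orbitEval_rTensor_rightOrbit, EntwinedCoaction.twist_apply, orbitEval_self]

lemma twist_coinvariantSubalgebra_smul (f : C →ₗ[R] A) (b : coinvariantSubalgebra ρA) (a : A) :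
    ρA.twist f (b • a) = b • ρA.twist f a :=
  twist_smul_of_coinvariant ρA ρA f (m := (b : A)) b.2 a

-- Colinearity turns ϱ(l(c)) into ∑ l(c₁) ⊗ c₂, which translates identities of operators on A into
-- identities of convolution.
variable {ρA} in
lemma IsIntegral.twist_apply {l : C →ₗ[R] A} (hl : IsIntegral ρA l) (f : C →ₗ[R] A) (c : C) :
    ρA.twist f (l c) = conv l f c := by
  rw [EntwinedCoaction.twist_apply, hl, orbitEval_self, conv_apply]

variable {ρA} in
/-- The convolution inverse `f` of an integral satisfies `∑ f (c₂)_ψ ⊗ c₁^ψ = f (c) ⊗ x`. -/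
lemma IsIntegral.aux_inverse {x : C} (h1 : ρA.ϱ 1 = 1 ⊗ₜ[R] x) {l f : C →ₗ[R] A}
    (hl : IsIntegral ρA l) (hlf : conv l f = convUnit R A C) (hfl : conv f l = convUnit R A C)
    (c : C) : Smash.aux E f c = f c ⊗ₜ[R] x := by
  -- Left convolution by l is cancelled. Convolving the left side with l gives ϱ(T_f(l(c))) =
  -- ϱ((l⋆f)(c)) = ε(c) 1 ⊗ x, and f convolved with c ↦ ε(c) 1 ⊗ x is f(c) ⊗ x.
  rw [orbitMap_injective hfl (k := (LinearMap.toSpanSingleton R _ (1 ⊗ₜ[R] x)) ∘ₗ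
    Coalgebra.counit), orbitMap_convUnit]
  · simp
  · intro c
    rw [← hl, ← EntwinedCoaction.rho_twist, hl.twist_apply, hlf, convUnit_apply]
    simp [h1]

-- Inserting `aux_inverse` into `rho_twist` gives ϱ(T_f(m)) = ∑ m₀ f(m₁) ⊗ x, which is the
-- coinvariance condition.
variable {ρA} in
lemma IsIntegral.twist_inverse_mem {x : C} (h1 : ρA.ϱ 1 = 1 ⊗ₜ[R] x) {l f : C →ₗ[R] A}
    (hl : IsIntegral ρA l) (hlf : conv l f = convUnit R A C) (hfl : conv f l = convUnit R A C)
    (m : M) : ρM.twist f m ∈ coinvariants ρA ρM := by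
  rw [mem_coinvariants_iff ρA ρM h1, EntwinedCoaction.rho_twist, EntwinedCoaction.twist_apply]
  generalize ρM.ϱ m = z
  induction z with
  | zero => simp
  | add x y hx hy => simp only [map_add, TensorProduct.add_tmul, hx, hy]
  | tmul m c => simp [hl.aux_inverse h1 hlf hfl]

end Coinvariants

/-! ### The normal basis property -/

/-- A right `C`-colinear map `l : C → A` and a left `B`-linear map `p : A → B` with
`p (l (c)) = ε (c) 1` and `∑ p (a₀) l (a₁) = a`. -/
structure IsNormalPair (l : C →ₗ[R] A)
    (p : A →ₗ[↥(coinvariantSubalgebra ρA)] ↥(coinvariantSubalgebra ρA)) : Prop where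
  isIntegral : IsIntegral ρA l
  apply_apply : ∀ c, p (l c) = (Coalgebra.counit c : R) • 1
  evalMul_rTensor : ∀ a, evalMul l (((coinvariantSubalgebra ρA).val.toLinearMap ∘ₗ
    p.restrictScalars R).rTensor C (ρA.ϱ a)) = a

section NormalBasis

variable {ρA}

lemma rTensor_rho_smul (p : A →ₗ[↥(coinvariantSubalgebra ρA)] ↥(coinvariantSubalgebra ρA))
    (b : coinvariantSubalgebra ρA) (a : A) :
    (p.restrictScalars R).rTensor C (ρA.ϱ (b • a)) =
      b • (p.restrictScalars R).rTensor C (ρA.ϱ a) := by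
  rw [rho_coinvariantSubalgebra_smul]
  generalize ρA.ϱ a = z
  induction z with
  | zero => simp
  | add x y hx hy => simp only [map_add, smul_add, hx, hy]
  | tmul a c =>
    have h : p ((b : A) * a) = b • p a := p.map_smul b a
    simp [TensorProduct.smul_tmul', h]

/-- The mutually inverse maps are a ↦ ∑ p(a₀) ⊗ a₁ and b ⊗ c ↦ b l(c). One composite is the third
axiom of the pair; the other reduces by B-linearity to ∑ p(l(c₁)) ⊗ c₂ = 1 ⊗ c. Colinearity is
coassociativity of ϱ. -/
lemma IsNormalPair.hasRightNormalBasis {l : C →ₗ[R] A}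
    {p : A →ₗ[↥(coinvariantSubalgebra ρA)] ↥(coinvariantSubalgebra ρA)}
    (h : IsNormalPair ρA l p) : HasRightNormalBasis ρA := by
  let G : ↥(coinvariantSubalgebra ρA) ⊗[R] C →ₗ[R] A :=
    evalMul l ∘ₗ (coinvariantSubalgebra ρA).val.toLinearMap.rTensor C
  have hp : ∀ c, (p.restrictScalars R).rTensor C (ρA.ϱ (l c)) = 1 ⊗ₜ[R] c := by
    intro c
    have h1 : ∀ w : C ⊗[R] C, (p.restrictScalars R).rTensor C (l.rTensor C w) =
        1 ⊗ₜ[R] TensorProduct.lid R C (Coalgebra.counit.rTensor C w) := by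
      intro w
      induction w with
      | zero => simp
      | add x y hx hy => simp only [map_add, TensorProduct.tmul_add, hx, hy]
      | tmul c d => simp [h.apply_apply, TensorProduct.smul_tmul]
    rw [h.isIntegral, h1, Coalgebra.rTensor_counit_comul, TensorProduct.lid_tmul, one_smul]
  refine ⟨{ toFun := fun a => (p.restrictScalars R).rTensor C (ρA.ϱ a)
            map_add' := fun a a' => by rw [map_add, map_add]
            map_smul' := rTensor_rho_smul p
            invFun := G
            left_inv := fun a => ?_
            right_inv := fun z => ?_ }, fun a => ?_⟩
  · rw [LinearMap.comp_apply, ← LinearMap.rTensor_comp_apply]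
    exact h.evalMul_rTensor a
  · change (p.restrictScalars R).rTensor C (ρA.ϱ (G z)) = z
    induction z with
    | zero => simp
    | add x y hx hy => rw [map_add, map_add, map_add, hx, hy]
    | tmul b c =>
      have hb : G (b ⊗ₜ[R] c) = b • l c := rfl
      rw [hb, rTensor_rho_smul, hp, TensorProduct.smul_tmul', smul_eq_mul, mul_one]
  · have hθ : ∀ z : A ⊗[R] C, Coalgebra.comul.lTensor _ ((p.restrictScalars R).rTensor C z) =
        (p.restrictScalars R).rTensor (C ⊗[R] C) (Coalgebra.comul.lTensor A z) := by
      intro z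
      rw [← LinearMap.comp_apply, ← LinearMap.comp_apply, LinearMap.rTensor_comp_lTensor,
        LinearMap.lTensor_comp_rTensor]
    change Coalgebra.comul.lTensor _ ((p.restrictScalars R).rTensor C (ρA.ϱ a)) =
      TensorProduct.assoc R _ C C
        (((p.restrictScalars R).rTensor C ∘ₗ ρA.ϱ).rTensor C (ρA.ϱ a))
    rw [hθ, ← ρA.coassoc, LinearMap.rTensor_comp_apply, assoc_rTensor_rTensor]

/-- The pair is l(c) = θ⁻¹(1 ⊗ c) and p = (id ⊗ ε) ∘ θ. -/
lemma HasRightNormalBasis.exists_isNormalPair (h : HasRightNormalBasis ρA) :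
    ∃ l p, IsNormalPair ρA l p := by
  obtain ⟨θ, hθ⟩ := h
  have hθ' : ∀ a, (θ.toLinearMap.restrictScalars R).rTensor C (ρA.ϱ a) =
      (TensorProduct.assoc R _ C C).symm (Coalgebra.comul.lTensor _ (θ a)) := fun a => by
    rw [hθ, LinearEquiv.symm_apply_apply]
  let e : ↥(coinvariantSubalgebra ρA) ⊗[R] C →ₗ[↥(coinvariantSubalgebra ρA)]
      ↥(coinvariantSubalgebra ρA) :=
    { toFun := fun z => TensorProduct.rid R _ (Coalgebra.counit.lTensor _ z)
      map_add' := fun z z' => by rw [map_add, map_add]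
      map_smul' := fun b z => by
        rw [RingHom.id_apply]
        induction z with
        | zero => simp
        | add x y hx hy => simp only [map_add, smul_add, hx, hy]
        | tmul b' c => simp [TensorProduct.smul_tmul'] }
  let l : C →ₗ[R] A := (θ.symm.toLinearMap.restrictScalars R) ∘ₗ
    TensorProduct.mk R ↥(coinvariantSubalgebra ρA) C 1
  have he : ∀ b c, e (b ⊗ₜ[R] c) = (Coalgebra.counit c : R) • b := fun b c => by simp [e]
  have hl : ∀ c, θ (l c) = 1 ⊗ₜ[R] c := fun c => θ.apply_symm_apply _
  have hsymm : (θ.symm.toLinearMap.restrictScalars R) ∘ₗ (θ.toLinearMap.restrictScalars R) =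
      LinearMap.id := LinearMap.ext fun a => θ.symm_apply_apply a
  refine ⟨l, e ∘ₗ θ.toLinearMap, fun c => ?_, fun c => ?_, fun a => θ.injective ?_⟩
  -- The identity θ⁻¹ ∘ θ is inserted in the first tensor factor so that colinearity of θ applies to
  -- ϱ(l(c)).
  · rw [← LinearMap.id_apply (R := R) (ρA.ϱ (l c)), ← LinearMap.rTensor_id, ← hsymm,
      LinearMap.rTensor_comp_apply, hθ', hl, LinearMap.lTensor_tmul]
    generalize (Coalgebra.comul c : C ⊗[R] C) = w
    induction w with
    | zero => simp
    | add x y hx hy => simp only [map_add, TensorProduct.tmul_add, hx, hy]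
    | tmul c d => simp [l]
  · change e (θ (l c)) = _
    rw [hl, he]
  -- After applying θ the claim reads ∑ p(a₀) ⊗ a₁ = θ(a); by colinearity the left side is (id ⊗ ε ⊗
  -- id)(id ⊗ Δ) θ(a).
  · have h1 : ∀ z : ↥(coinvariantSubalgebra ρA) ⊗[R] C,
        θ (evalMul l ((coinvariantSubalgebra ρA).val.toLinearMap.rTensor C z)) = z := by
      intro z
      induction z with
      | zero => simp
      | add x y hx hy => simp only [map_add, hx, hy]
      | tmul b c =>
        change θ (b • l c) = _
        rw [map_smul, hl, TensorProduct.smul_tmul', smul_eq_mul, mul_one]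
    have h2 : ∀ z : ↥(coinvariantSubalgebra ρA) ⊗[R] C, (e.restrictScalars R).rTensor C
        ((TensorProduct.assoc R _ C C).symm (Coalgebra.comul.lTensor _ z)) = z := by
      intro z
      induction z with
      | zero => simp
      | add x y hx hy => simp only [map_add, hx, hy]
      | tmul b c =>
        have h3 : ∀ w : C ⊗[R] C, (e.restrictScalars R).rTensor C
            ((TensorProduct.assoc R _ C C).symm (b ⊗ₜ[R] w)) =
              b ⊗ₜ[R] TensorProduct.lid R C (Coalgebra.counit.rTensor C w) := by
          intro w
          induction w with
          | zero => simp
          | add x y hx hy => simp only [map_add, TensorProduct.tmul_add, hx, hy]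
          | tmul c d => simp [he, TensorProduct.smul_tmul]
        rw [LinearMap.lTensor_tmul, h3, Coalgebra.rTensor_counit_comul, TensorProduct.lid_tmul,
          one_smul]
    have h4 : (e ∘ₗ θ.toLinearMap).restrictScalars R =
      (e.restrictScalars R) ∘ₗ (θ.toLinearMap.restrictScalars R) := rfl
    rw [LinearMap.rTensor_comp_apply, h1, h4, LinearMap.rTensor_comp_apply, hθ', h2]

/-- A convolution invertible integral has a complement. -/
lemma IsIntegral.exists_isNormalPair {x : C} (h1 : ρA.ϱ 1 = 1 ⊗ₜ[R] x) {l f : C →ₗ[R] A}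
    (hl : IsIntegral ρA l) (hlf : conv l f = convUnit R A C) (hfl : conv f l = convUnit R A C) :
    ∃ p, IsNormalPair ρA l p ∧ ∀ a, (p a : A) = ρA.twist f a := by
  refine ⟨{ toFun := fun a => ⟨ρA.twist f a, hl.twist_inverse_mem ρA h1 hlf hfl a⟩
            map_add' := fun a a' => Subtype.ext (map_add _ _ _)
            map_smul' := fun b a => Subtype.ext (twist_coinvariantSubalgebra_smul ρA f b a) },
    ⟨hl, fun c => Subtype.ext ?_, fun a => ?_⟩, fun a => rfl⟩
  · change ρA.twist f (l c) = (Coalgebra.counit c : R) • (1 : A)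
    rw [hl.twist_apply, hlf, convUnit_apply]
  · rw [← orbitEval_self]
    exact (ρA.orbitEval_rTensor_twist f l a).trans (by rw [hfl, ρA.twist_convUnit])

end NormalBasis

lemma isCleft_iff : IsCleft ρA ↔ ∃ l f : C →ₗ[R] A, IsIntegral ρA l ∧
    conv l f = convUnit R A C ∧ conv f l = convUnit R A C := by
  simp only [IsCleft, isUnit_toConv_iff]
  exact exists_congr fun l => by rw [exists_and_left]

/-! ### The map `Λ` -/

section Lam

variable {ρA}

/-- A linear map `C → A` as an element of `#_ψ^{op} (C, A)`. -/
def Smash.ofLinearMap (f : C →ₗ[R] A) : E.Smash := f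

lemma Smash.toLinearMap_ofLinearMap (f : C →ₗ[R] A) :
    (Smash.ofLinearMap f : E.Smash).toLinearMap = f := rfl

lemma unop_Lam_apply (g : E.Smash) (a : A) : unop (Lam ρA g) a = ρA.twist g.toLinearMap a := by
  rw [EntwinedCoaction.twist_apply, orbitEval_self]
  rfl

/-- Evaluating Λ(g) at l(c) gives (l ⋆ g)(c), and l has the left convolution inverse f. -/
lemma Lam_injective {l f : C →ₗ[R] A} (hl : IsIntegral ρA l)
    (hfl : conv f l = convUnit R A C) : Function.Injective (Lam ρA) := by
  intro g g' hg
  have h : ∀ a, ρA.twist g.toLinearMap a = ρA.twist g'.toLinearMap a := fun a => by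
    rw [← unop_Lam_apply, ← unop_Lam_apply, hg]
  have key : ∀ g : C →ₗ[R] A, conv f (conv l g) = g := by
    intro g
    have h1 : WithConv.toConv f * WithConv.toConv l = 1 :=
      congrArg WithConv.toConv ((ofConv_mul (WithConv.toConv f) (WithConv.toConv l)).trans hfl)
    have h2 : WithConv.toConv f * (WithConv.toConv l * WithConv.toConv g) = WithConv.toConv g := by
      rw [← mul_assoc, h1, one_mul]
    have h3 := congrArg WithConv.ofConv h2
    rwa [ofConv_mul, ofConv_mul] at h3
  have h4 : conv l g.toLinearMap = conv l g'.toLinearMap := by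
    ext c
    rw [← hl.twist_apply, ← hl.twist_apply, h]
  exact (key g.toLinearMap).symm.trans ((congrArg (conv f) h4).trans (key g'.toLinearMap))

/-- Since a = ∑ p(a₀) l(a₁) and p takes values in B, a B-linear φ satisfies φ(a) = ∑ p(a₀) φ(l(a₁))
= T_{f ⋆ (φ∘l)}(a). -/
lemma Lam_conv {l f : C →ₗ[R] A} (hfl : conv f l = convUnit R A C)
    {p : A →ₗ[↥(coinvariantSubalgebra ρA)] ↥(coinvariantSubalgebra ρA)}
    (hp : ∀ a, (p a : A) = ρA.twist f a) (φ : Module.End ↥(coinvariantSubalgebra ρA) A) :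
    Lam ρA (Smash.ofLinearMap (conv f (φ.restrictScalars R ∘ₗ l))) = op φ := by
  refine MulOpposite.unop_injective (LinearMap.ext fun a => ?_)
  have h1 : ∀ z : A ⊗[R] C, evalMul (φ.restrictScalars R ∘ₗ l) ((ρA.twist f).rTensor C z) =
      φ (evalMul l ((ρA.twist f).rTensor C z)) := by
    intro z
    induction z with
    | zero => simp
    | add x y hx hy => simp only [map_add, hx, hy]
    | tmul a c =>
      rw [LinearMap.rTensor_tmul, evalMul_tmul, evalMul_tmul, ← hp]
      exact (φ.map_smul (p a) (l c)).symm
  rw [unop_Lam_apply, MulOpposite.unop_op, Smash.toLinearMap_ofLinearMap,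
    ← EntwinedCoaction.orbitEval_rTensor_twist, orbitEval_self, h1, ← orbitEval_self,
    EntwinedCoaction.orbitEval_rTensor_twist, hfl, EntwinedCoaction.twist_convUnit]

/-- By `rho_twist`, T_g(T_f(a)) = ∑ a₀ f(a₂)_ψ g(a₁^ψ) = T_{f·g}(a); the reversed order of
composition accounts for the opposite ring. -/
lemma Lam_mul (f g : E.Smash) : Lam ρA (f * g) = Lam ρA f * Lam ρA g := by
  refine MulOpposite.unop_injective (LinearMap.ext fun a => ?_)
  rw [MulOpposite.unop_mul, Module.End.mul_apply, unop_Lam_apply, unop_Lam_apply, unop_Lam_apply,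
    EntwinedCoaction.twist_apply, EntwinedCoaction.twist_apply ρA g.toLinearMap,
    EntwinedCoaction.rho_twist]
  generalize ρA.ϱ a = z
  induction z with
  | zero => simp
  | add x y hx hy => simp only [map_add, hx, hy]
  | tmul a c =>
    rw [orbitEval_self, orbitEval_self, orbitMap_tmul, evalMul_rTensor_rightOrbit, evalMul_tmul]
    rfl

lemma Lam_add (f g : E.Smash) : Lam ρA (f + g) = Lam ρA f + Lam ρA g := by
  refine MulOpposite.unop_injective (LinearMap.ext fun a => ?_)
  change evalMul (f.toLinearMap + g.toLinearMap) (ρA.ϱ a) =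
    evalMul f.toLinearMap (ρA.ϱ a) + evalMul g.toLinearMap (ρA.ϱ a)
  simp [evalMul, LinearMap.lTensor_add]

lemma IsCleft.lamIsRingIso {x : C} (h1 : ρA.ϱ 1 = 1 ⊗ₜ[R] x) (h : IsCleft ρA) :
    LamIsRingIso ρA := by
  obtain ⟨l, f, hl, hlf, hfl⟩ := (isCleft_iff ρA).1 h
  obtain ⟨p, -, hp⟩ := hl.exists_isNormalPair h1 hlf hfl
  let F : E.Smash →+* (Module.End ↥(coinvariantSubalgebra ρA) A)ᵐᵒᵖ :=
    { toFun := Lam ρA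
      map_one' := MulOpposite.unop_injective (LinearMap.ext fun a => by
        rw [unop_Lam_apply]
        exact ρA.twist_convUnit a)
      map_mul' := Lam_mul
      map_zero' := by simpa using Lam_add (ρA := ρA) 0 0
      map_add' := Lam_add }
  exact ⟨RingEquiv.ofBijective F
    ⟨Lam_injective hl hfl, fun φ => ⟨_, Lam_conv hfl hp (unop φ)⟩⟩, fun _ => rfl⟩

lemma LamIsRingIso.isCleft (h : LamIsRingIso ρA) (hb : HasRightNormalBasis ρA) : IsCleft ρA := by
  obtain ⟨l, p, hlp⟩ := hb.exists_isNormalPair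
  obtain ⟨e, he⟩ := h
  let ι : ↥(coinvariantSubalgebra ρA) →ₗ[↥(coinvariantSubalgebra ρA)] A :=
    { toFun := Subtype.val
      map_add' := fun _ _ => rfl
      map_smul' := fun _ _ => rfl }
  -- The candidate inverse of l is the f with T_f = p, regarded as an endomorphism of A.
  obtain ⟨f, hf⟩ := e.surjective (op (ι ∘ₗ p))
  have hfp : ρA.twist f.toLinearMap =
      (coinvariantSubalgebra ρA).val.toLinearMap ∘ₗ p.restrictScalars R := by
    ext a
    rw [← unop_Lam_apply, ← he, hf]
    rfl
  refine (isCleft_iff ρA).2 ⟨l, f.toLinearMap, hlp.isIntegral, ?_, ?_⟩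
  · ext c
    rw [← hlp.isIntegral.twist_apply, hfp, convUnit_apply]
    change (p (l c) : A) = _
    rw [hlp.apply_apply]
    rfl
  -- The identity f ⋆ l = ε is tested through the injective Λ: T_{f⋆l}(a) = ∑ p(a₀) l(a₁) = a.
  · refine e.injective (a₁ := Smash.ofLinearMap (conv f.toLinearMap l))
      (a₂ := Smash.ofLinearMap (convUnit R A C)) ?_
    rw [he, he]
    refine MulOpposite.unop_injective (LinearMap.ext fun a => ?_)
    rw [unop_Lam_apply, unop_Lam_apply, Smash.toLinearMap_ofLinearMap,
      Smash.toLinearMap_ofLinearMap, ← EntwinedCoaction.orbitEval_rTensor_twist, hfp, orbitEval_self, hlp.evalMul_rTensor,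
      EntwinedCoaction.twist_convUnit]

end Lam

/-! ### Galois extensions with a normal basis are cleft -/

section Galois

variable {ρA}

lemma galoisMap_tmul (a' a : A) :
    galoisMap ρA (Induced.tmul ρA a' a) = (rightOrbit R a').rTensor C (ρA.ϱ a) := by
  have h : galoisMap ρA (Induced.tmul ρA a' a) =
    twistedAction E.ψ a ((rightOrbit R a').rTensor C (ρA.ϱ 1)) := BalancedTensor.lift_tmul _ _ _ _
  rw [h, rTensor_rightOrbit_smul, ← ρA.rho_eq]

/-- The map a ⊗_B a' ↦ a p(a') is well defined because p is left B-linear. Transported by β⁻¹ it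
becomes ν : A ⊗ C → A with ν(a ϱ(a')) = a p(a'). It is left A-linear, hence of the form a ⊗ c ↦ a
f(c), and f is the convolution inverse of l. -/
lemma IsGalois.isCleft (h : IsGalois ρA) (hb : HasRightNormalBasis ρA) : IsCleft ρA := by
  obtain ⟨l, p, hlp⟩ := hb.exists_isNormalPair
  let q : A →ₗ[R] A := (coinvariantSubalgebra ρA).val.toLinearMap ∘ₗ p.restrictScalars R
  have hq : ∀ (b : coinvariantSubalgebra ρA) a, q (b * a) = b * q a := fun b a =>
    congrArg Subtype.val (p.map_smul b a)
  let κ : Induced ρA A →ₗ[R] A := BalancedTensor.lift ((LinearMap.mul R A).compl₂ q)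
    (fun a b a' => by
      change (a * (b : A)) * q a' = a * q (b * a')
      rw [hq, mul_assoc])
  have hκ : ∀ a a', κ (Induced.tmul ρA a a') = a * q a' := fun a a' =>
    BalancedTensor.lift_tmul _ _ a a'
  let β : Induced ρA A ≃ₗ[R] A ⊗[R] C := LinearEquiv.ofBijective (galoisMap ρA) h
  let ν : A ⊗[R] C →ₗ[R] A := κ ∘ₗ β.symm.toLinearMap
  have hν : ∀ a a', ν ((rightOrbit R a).rTensor C (ρA.ϱ a')) = a * q a' := fun a a' => by
    rw [← galoisMap_tmul, ← hκ]
    exact congrArg κ (β.symm_apply_apply _)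
  have hνρ : ∀ a, ν (ρA.ϱ a) = q a := fun a => by
    rw [← rTensor_rightOrbit_one (ρA.ϱ a), hν, one_mul]
  have hνa : ∀ a w, ν ((rightOrbit R a).rTensor C w) = a * ν w := by
    intro a w
    obtain ⟨z, rfl⟩ := h.surjective w
    refine Induced.induction_on ρA z (by simp) (fun a' a'' => ?_)
      (fun x y hx hy => by simp only [map_add, mul_add, hx, hy])
    rw [galoisMap_tmul, ← rTensor_rightOrbit_comp, hν, hν, op_smul_eq_mul, mul_assoc]
  let f : C →ₗ[R] A := ν ∘ₗ TensorProduct.mk R A C 1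
  have hf : ν = evalMul f := TensorProduct.ext' fun a c => by
    rw [evalMul_tmul]
    exact (congrArg ν (by simp)).trans (hνa a (1 ⊗ₜ[R] c))
  refine (isCleft_iff ρA).2 ⟨l, f, hlp.isIntegral, ?_, ?_⟩
  · ext c
    rw [conv_apply, ← hf, ← hlp.isIntegral, hνρ, convUnit_apply]
    change (p (l c) : A) = _
    rw [hlp.apply_apply]
    rfl
  -- As β is surjective, this needs checking only at w = a ϱ(a'), where both sides equal a a' by the
  -- third axiom of the pair and the counit. The case w = 1 ⊗ c is f ⋆ l = ε.
  · have h1 : ∀ w : A ⊗[R] C, evalMul l (ν.rTensor C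
        ((TensorProduct.assoc R A C C).symm (Coalgebra.comul.lTensor A w))) =
          TensorProduct.rid R A (Coalgebra.counit.lTensor A w) := by
      intro w
      obtain ⟨z, rfl⟩ := h.surjective w
      refine Induced.induction_on ρA z (by simp) (fun a a' => ?_)
        (fun x y hx hy => by simp only [map_add, hx, hy])
      have h2 : Coalgebra.comul.lTensor A ((rightOrbit R a).rTensor C (ρA.ϱ a')) =
          (rightOrbit R a).rTensor (C ⊗[R] C) (Coalgebra.comul.lTensor A (ρA.ϱ a')) :=
        LinearMap.congr_fun ((LinearMap.lTensor_comp_rTensor _ _ _).trans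
          (LinearMap.rTensor_comp_lTensor _ _ _).symm) _
      have h3 : ν ∘ₗ (rightOrbit R a).rTensor C ∘ₗ ρA.ϱ = rightOrbit R a ∘ₗ q :=
        LinearMap.ext fun a' => hν a a'
      have h4 : ∀ z : A ⊗[R] C, evalMul l ((rightOrbit R a ∘ₗ q).rTensor C z) =
          a * evalMul l (q.rTensor C z) := fun z => by
        rw [LinearMap.rTensor_comp_apply, evalMul_rTensor_rightOrbit]
      rw [galoisMap_tmul, h2, ← ρA.coassoc, ← assoc_rTensor_rTensor,
        LinearEquiv.symm_apply_apply, ← LinearMap.rTensor_comp_apply,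
        ← LinearMap.rTensor_comp_apply, LinearMap.comp_assoc, h3, h4, hlp.evalMul_rTensor,
        ← orbitEval_convUnit (A := A) (M := A), orbitEval_self, evalMul_rTensor_rightOrbit, ← orbitEval_self,
        ← EntwinedCoaction.twist_apply, EntwinedCoaction.twist_convUnit]
    ext c
    have h2 := h1 (1 ⊗ₜ[R] c)
    rw [LinearMap.lTensor_tmul, LinearMap.lTensor_tmul, TensorProduct.rid_tmul,
      ← convUnit_apply] at h2
    rw [← h2, conv_apply]
    generalize (Coalgebra.comul c : C ⊗[R] C) = w
    congr 1
    induction w with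
    | zero => simp
    | add x y hx hy => simp only [map_add, TensorProduct.tmul_add, hx, hy]
    | tmul c d => simp [f]

end Galois

/-! ### The structure theorems for cleft extensions -/

section Structure

variable {ρA}

lemma Psi_tmul {M : Type*} [AddCommGroup M] [Module R M] [Module Aᵐᵒᵖ M]
    [IsScalarTower R Aᵐᵒᵖ M] (ρM : E.EntwinedCoaction M) (m : coinvariants ρA ρM) (a : A) :
    Psi ρA ρM (Induced.tmul ρA m a) = op a • (m : M) :=
  BalancedTensor.lift_tmul _ _ m a

/-- The inverse is m ↦ ∑ T_f(m₀) ⊗_B l(m₁). On m a with m coinvariant it gives ∑ m T_f(a₀) ⊗_B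
l(a₁); since T_f(a₀) lies in B it crosses the tensor sign, leaving m ⊗_B a. -/
lemma IsCleft.bijective_Psi {x : C} (h1 : ρA.ϱ 1 = 1 ⊗ₜ[R] x) (h : IsCleft ρA)
    {M : Type*} [AddCommGroup M] [Module R M] [Module Aᵐᵒᵖ M]
    [IsScalarTower R Aᵐᵒᵖ M] (ρM : E.EntwinedCoaction M) : Function.Bijective (Psi ρA ρM) := by
  obtain ⟨l, f, hl, hlf, hfl⟩ := (isCleft_iff ρA).1 h
  obtain ⟨p, hlp, hp⟩ := hl.exists_isNormalPair h1 hlf hfl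
  let π : M →ₗ[R] ↥(coinvariants ρA ρM) :=
    { toFun := fun m => ⟨ρM.twist f m, hl.twist_inverse_mem ρM h1 hlf hfl m⟩
      map_add' := fun m m' => Subtype.ext (map_add _ _ _)
      map_smul' := fun r m => Subtype.ext ((ρM.twist f).map_smul r m) }
  let P : M ⊗[R] C →ₗ[R] Induced ρA ↥(coinvariants ρA ρM) :=
    TensorProduct.lift ((Induced.mk ρA).compl₁₂ π l)
  have hP : ∀ m c, P (m ⊗ₜ[R] c) = Induced.tmul ρA (π m) (l c) := fun _ _ => rfl
  refine Function.bijective_iff_has_inverse.2 ⟨fun m => P (ρM.ϱ m), fun z => ?_, fun m => ?_⟩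
  · refine Induced.induction_on ρA z (by simp) (fun m a => ?_)
      (fun x y hx hy => by simp only [map_add, hx, hy])
    have h2 : ∀ z : A ⊗[R] C, P ((rightOrbit R (m : M)).rTensor C z) =
        Induced.mk ρA m (evalMul l ((ρA.twist f).rTensor C z)) := by
      intro z
      induction z with
      | zero => simp
      | add x y hx hy => simp only [map_add, hx, hy]
      | tmul a c =>
        have hπ : π (op a • (m : M)) = op (p a) • m := Subtype.ext <|
          (twist_smul_of_coinvariant ρA ρM f m.2 a).trans (by rw [← hp]; rfl)
        rw [LinearMap.rTensor_tmul, rightOrbit_apply, hP, hπ, Induced.smul_tmul, hp]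
        rfl
    change P (ρM.ϱ (Psi ρA ρM (Induced.tmul ρA m a))) = _
    rw [Psi_tmul, map_smul_of_coinvariant ρA ρM m.2, h2, ← orbitEval_self,
      EntwinedCoaction.orbitEval_rTensor_twist, hfl, EntwinedCoaction.twist_convUnit]
    rfl
  · have h2 : ∀ z : M ⊗[R] C, Psi ρA ρM (P z) = orbitEval M l ((ρM.twist f).rTensor C z) := by
      intro z
      induction z with
      | zero => simp
      | add x y hx hy => simp only [map_add, hx, hy]
      | tmul m c => rw [hP, Psi_tmul]; rfl
    change Psi ρA ρM (P (ρM.ϱ m)) = m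
    rw [h2, EntwinedCoaction.orbitEval_rTensor_twist, hfl, EntwinedCoaction.twist_convUnit]

lemma twist_inducedCoaction_tmul (f : C →ₗ[R] A) {N : Type*} [AddCommGroup N] [Module R N]
    [Module (↥(coinvariantSubalgebra ρA))ᵐᵒᵖ N] (n : N) (a : A) :
    (inducedCoaction ρA N).twist f (Induced.tmul ρA n a) = Induced.tmul ρA n (ρA.twist f a) := by
  change orbitEval _ f (Induced.coact ρA (Induced.tmul ρA n a)) =
    Induced.mk ρA n (orbitEval A f (ρA.ϱ a))
  rw [Induced.coact_tmul]
  generalize ρA.ϱ a = z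
  induction z with
  | zero => simp
  | add x y hx hy => simp only [map_add, hx, hy]
  | tmul a c =>
    rw [LinearMap.rTensor_tmul, orbitEval_tmul, orbitEval_tmul, Induced.mk_apply,
      Induced.op_smul_tmul, op_smul_eq_mul, Induced.mk_apply]

/-- The candidate n ⊗_B a ↦ n p(a) sends n ⊗_B 1 to n f(x), so it is corrected by l(x). As x is
group-like, f(x) l(x) = 1 and ϱ(l(x)) = l(x) ⊗ x, which puts l(x) in B. -/
lemma IsCleft.bijective_Phi {x : C} (hx : IsGroupLikeElem R x) (h1 : ρA.ϱ 1 = 1 ⊗ₜ[R] x)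
    (h : IsCleft ρA) (N : Type*) [AddCommGroup N] [Module R N]
    [Module (↥(coinvariantSubalgebra ρA))ᵐᵒᵖ N]
    [IsScalarTower R (↥(coinvariantSubalgebra ρA))ᵐᵒᵖ N] : Function.Bijective (Phi ρA N) := by
  obtain ⟨l, f, hl, hlf, hfl⟩ := (isCleft_iff ρA).1 h
  obtain ⟨p, hlp, hp⟩ := hl.exists_isNormalPair h1 hlf hfl
  have hconv : ∀ g k : C →ₗ[R] A, conv g k x = g x * k x := fun g k => by
    rw [conv_apply, hx.comul_eq_tmul_self]; rfl
  have hunit : convUnit R A C x = 1 := by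
    rw [convUnit_apply, hx.counit_eq_one, one_smul]
  have hfx : f x * l x = 1 := by rw [← hconv, hfl, hunit]
  have hlx : l x ∈ coinvariantSubalgebra ρA :=
    (mem_coinvariants_iff ρA ρA h1 (l x)).2 (by
      rw [hl, hx.comul_eq_tmul_self, LinearMap.rTensor_tmul])
  have hp1 : (p 1 : A) = f x := by
    rw [hp, EntwinedCoaction.twist_apply, h1, orbitEval_self, evalMul_tmul, one_mul]
  let q : A →ₗ[R] ↥(coinvariantSubalgebra ρA) :=
    LinearMap.mulRight R ⟨l x, hlx⟩ ∘ₗ p.restrictScalars R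
  have hq : ∀ a, q a = p a * ⟨l x, hlx⟩ := fun _ => rfl
  let Y : Induced ρA N →ₗ[R] N := BalancedTensor.lift ((rightOrbit R).compl₂ q) (fun n b a => by
    rw [LinearMap.compl₂_apply, LinearMap.compl₂_apply, rightOrbit_apply, rightOrbit_apply,
      ← mul_smul, ← MulOpposite.op_mul, hq, hq, map_smul, smul_eq_mul, mul_assoc])
  have hY : ∀ n a, Y (Induced.tmul ρA n a) = op (q a) • n := fun n a =>
    BalancedTensor.lift_tmul _ _ n a
  have hY' : ∀ z, Induced.tmul ρA (Y z) 1 = op (l x) • (inducedCoaction ρA N).twist f z := by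
    intro z
    change Induced.mk ρA (Y z) 1 = _
    refine Induced.induction_on ρA z (by simp) (fun n a => ?_)
      (fun x y hx hy => by simp only [map_add, LinearMap.add_apply, smul_add, hx, hy])
    rw [hY, Induced.mk_apply, Induced.smul_tmul, twist_inducedCoaction_tmul, Induced.op_smul_tmul,
      mul_one, hq, ← hp]
    rfl
  refine Function.bijective_iff_has_inverse.2 ⟨fun z => Y z, fun n => ?_, fun z => ?_⟩
  · change Y (Induced.tmul ρA n 1) = n
    have h2 : q 1 = 1 := Subtype.ext (by
      change (p 1 : A) * l x = 1
      rw [hp1, hfx])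
    rw [hY, h2, MulOpposite.op_one, one_smul]
  · refine Subtype.ext ?_
    change Induced.tmul ρA (Y z) 1 = z
    -- For coinvariant z, T_f(z) = z f(x), and multiplication by l(x) restores z.
    rw [hY', EntwinedCoaction.twist_apply, (mem_coinvariants_iff ρA _ h1 _).1 z.2, orbitEval_tmul,
      ← mul_smul, ← MulOpposite.op_mul, hfx, MulOpposite.op_one, one_smul]

end Structure

/-! ### The entwined module `A ⊗ C` -/

section Free

variable (E) in
/-- The `R`-module `A ⊗ C`, underlying an entwined module. -/
def Free : Type _ := (fun _ : EntwiningStructure R A C => A ⊗[R] C) E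

namespace Free

instance : AddCommGroup E.Free := inferInstanceAs (AddCommGroup (A ⊗[R] C))

instance : Module R E.Free := inferInstanceAs (Module R (A ⊗[R] C))

lemma twistedAction_mul (a b : A) (z : A ⊗[R] C) :
    twistedAction E.ψ (a * b) z = twistedAction E.ψ b (twistedAction E.ψ a z) := by
  induction z with
  | zero => simp
  | add x y hx hy => simp only [map_add, hx, hy]
  | tmul m c => rw [twistedAction_tmul, twistedAction_tmul, rTensor_rightOrbit_smul, E.map_mul]

lemma twistedAction_one : twistedAction (M := A) E.ψ 1 = LinearMap.id :=
  TensorProduct.ext' fun a c => by simp [E.map_one]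

lemma twistedAction_zero : twistedAction (M := A) E.ψ 0 = 0 :=
  TensorProduct.ext' fun a c => by simp

lemma twistedAction_add (a b : A) : twistedAction (M := A) E.ψ (a + b) =
    twistedAction E.ψ a + twistedAction E.ψ b :=
  TensorProduct.ext' fun a c => by simp [TensorProduct.tmul_add]

/-- The right action `(a ⊗ c) a' = ∑ a a'_ψ ⊗ c^ψ`. -/
instance : Module Aᵐᵒᵖ E.Free :=
  Module.compHom E.Free (show Aᵐᵒᵖ →+* Module.End R E.Free from
    { toFun := fun a => twistedAction (M := A) E.ψ (unop a)
      map_one' := twistedAction_one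
      map_mul' := fun _ _ => LinearMap.ext fun z => twistedAction_mul _ _ z
      map_zero' := twistedAction_zero
      map_add' := fun _ _ => twistedAction_add _ _ })

lemma op_smul_eq (a : A) (z : E.Free) : op a • z = twistedAction (M := A) E.ψ a z := rfl

instance : IsScalarTower R Aᵐᵒᵖ E.Free where
  smul_assoc r a z := by
    have h : twistedAction (M := A) E.ψ (r • unop a) = r • twistedAction (M := A) E.ψ (unop a) :=
      TensorProduct.ext' fun a c => by simp
    exact LinearMap.congr_fun h z

/-- The coaction `id ⊗ Δ` on `A ⊗ C`. -/
def coact : A ⊗[R] C →ₗ[R] (A ⊗[R] C) ⊗[R] C :=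
  (TensorProduct.assoc R A C C).symm.toLinearMap ∘ₗ Coalgebra.comul.lTensor A

lemma coact_tmul (a : A) (c : C) : coact (a ⊗ₜ[R] c) =
    (TensorProduct.mk R A C a).rTensor C (Coalgebra.comul c) := by
  change (TensorProduct.assoc R A C C).symm (a ⊗ₜ[R] Coalgebra.comul c) = _
  generalize (Coalgebra.comul c : C ⊗[R] C) = w
  induction w with
  | zero => simp
  | add x y hx hy => simp only [map_add, TensorProduct.tmul_add, hx, hy]
  | tmul c d => simp

lemma coact_coassoc (z : A ⊗[R] C) :
    TensorProduct.assoc R (A ⊗[R] C) C C (coact.rTensor C (coact z)) =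
      Coalgebra.comul.lTensor (A ⊗[R] C) (coact z) := by
  induction z with
  | zero => simp
  | add x y hx hy => simp only [map_add, hx, hy]
  | tmul a c =>
    have h : coact ∘ₗ TensorProduct.mk R A C a =
      (TensorProduct.mk R A C a).rTensor C ∘ₗ Coalgebra.comul := LinearMap.ext (coact_tmul a)
    have h2 : ∀ w : C ⊗[R] C, Coalgebra.comul.lTensor (A ⊗[R] C)
        ((TensorProduct.mk R A C a).rTensor C w) =
          (TensorProduct.mk R A C a).rTensor (C ⊗[R] C) (Coalgebra.comul.lTensor C w) := by
      intro w
      rw [← LinearMap.comp_apply, ← LinearMap.comp_apply, LinearMap.rTensor_comp_lTensor,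
        LinearMap.lTensor_comp_rTensor]
    rw [coact_tmul, ← LinearMap.rTensor_comp_apply, h, LinearMap.rTensor_comp_apply,
      assoc_rTensor_rTensor, Coalgebra.coassoc_apply, h2]

lemma coact_counit (z : A ⊗[R] C) :
    TensorProduct.rid R (A ⊗[R] C) (Coalgebra.counit.lTensor (A ⊗[R] C) (coact z)) = z := by
  induction z with
  | zero => simp
  | add x y hx hy => simp only [map_add, hx, hy]
  | tmul a c =>
    have h : ∀ w : C ⊗[R] C, TensorProduct.rid R (A ⊗[R] C) (Coalgebra.counit.lTensor (A ⊗[R] C)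
        ((TensorProduct.mk R A C a).rTensor C w)) =
          a ⊗ₜ[R] TensorProduct.rid R C (Coalgebra.counit.lTensor C w) := by
      intro w
      induction w with
      | zero => simp
      | add x y hx hy => simp only [map_add, TensorProduct.tmul_add, hx, hy]
      | tmul c d => simp
    rw [coact_tmul, h, Coalgebra.lTensor_counit_comul, TensorProduct.rid_tmul, one_smul]

/-- Compatibility of id ⊗ Δ with the twisted action is the comultiplication axiom `map_comul` of the
entwining. -/
lemma coact_smul (z : E.Free) (a : A) : (coact (op a • z : E.Free) : E.Free ⊗[R] C) =
    twistedAction (M := E.Free) E.ψ a (coact z : E.Free ⊗[R] C) := by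
  rw [op_smul_eq]
  refine TensorProduct.induction_on (motive := fun z : A ⊗[R] C =>
    (coact (twistedAction (M := A) E.ψ a z) : (A ⊗[R] C) ⊗[R] C) =
      twistedAction (M := E.Free) E.ψ a (coact z : (A ⊗[R] C) ⊗[R] C)) z ?_ ?_ ?_
  · rw [map_zero, map_zero]
    exact (map_zero (twistedAction (M := E.Free) E.ψ a)).symm
  · intro b c
    have h1 : ∀ y : A ⊗[R] C, coact ((rightOrbit R b).rTensor C y) =
        ((rightOrbit R b).rTensor C).rTensor C
          ((TensorProduct.assoc R A C C).symm (Coalgebra.comul.lTensor A y)) := by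
      intro y
      rw [← (TensorProduct.assoc R A C C).injective.eq_iff, assoc_rTensor_rTensor,
        LinearEquiv.apply_symm_apply, coact, LinearMap.comp_apply]
      rw [LinearEquiv.coe_coe, LinearEquiv.apply_symm_apply, ← LinearMap.comp_apply,
        ← LinearMap.comp_apply, LinearMap.rTensor_comp_lTensor, LinearMap.lTensor_comp_rTensor]
    rw [twistedAction_tmul, h1, E.map_comul, LinearEquiv.symm_apply_apply, coact_tmul]
    generalize (Coalgebra.comul c : C ⊗[R] C) = w
    induction w with
    | zero =>
      simp only [TensorProduct.zero_tmul, map_zero]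
      exact (map_zero (twistedAction (M := E.Free) E.ψ a)).symm
    | add x y hx hy =>
      simp only [TensorProduct.add_tmul, map_add, hx, hy]
      exact (map_add (twistedAction (M := E.Free) E.ψ a) _ _).symm
    | tmul c d =>
      -- The orbit map on the right uses the twisted action of `E.Free`, (b ⊗ c) a' = ∑ b a'_ψ ⊗
      -- c^ψ, which absorbs the outer application of ψ.
      have h2 : ∀ y : A ⊗[R] C, ((rightOrbit R b).rTensor C).rTensor C
          (E.ψ.rTensor C ((TensorProduct.assoc R C A C).symm (c ⊗ₜ[R] y))) =
            (rightOrbit (A := A) (M := E.Free) R (b ⊗ₜ[R] c : A ⊗[R] C)).rTensor C y := by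
        intro y
        induction y with
        | zero =>
          simp only [TensorProduct.tmul_zero, map_zero]
          exact (map_zero ((rightOrbit (A := A) (M := E.Free) R (b ⊗ₜ[R] c : A ⊗[R] C)).rTensor C)).symm
        | add x y hx hy =>
          rw [TensorProduct.tmul_add, map_add, map_add, map_add, hx, hy]
          exact (map_add ((rightOrbit (A := A) (M := E.Free) R (b ⊗ₜ[R] c : A ⊗[R] C)).rTensor C) x y).symm
        | tmul a' d' => rfl
      exact h2 (E.ψ (d ⊗ₜ[R] a))
  · intro x y hx hy
    rw [map_add, map_add, map_add, hx, hy]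
    exact (map_add (twistedAction (M := E.Free) E.ψ a) _ _).symm

variable (E) in
/-- The entwined module `A ⊗ C` with coaction `id ⊗ Δ`. -/
def coaction : E.EntwinedCoaction E.Free where
  ϱ := coact
  coassoc := coact_coassoc
  counit := coact_counit
  map_smul := coact_smul

/-- The coinvariants of `A ⊗ C` are the elements `a ⊗ x`. -/
def coinvariantsEquiv {x : C} (hx : IsGroupLikeElem R x) (h1 : ρA.ϱ 1 = 1 ⊗ₜ[R] x) :
    A ≃ₗ[R] ↥(coinvariants ρA (coaction E)) where
  toFun a := ⟨(a ⊗ₜ[R] x : A ⊗[R] C), (mem_coinvariants_iff ρA (coaction E) h1 _).2 (by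
    change coact (a ⊗ₜ[R] x) = _
    rw [coact_tmul, hx.comul_eq_tmul_self]
    rfl)⟩
  map_add' a a' := Subtype.ext (TensorProduct.add_tmul a a' x)
  map_smul' r a := Subtype.ext (TensorProduct.smul_tmul' r a x).symm
  invFun z := TensorProduct.rid R A (Coalgebra.counit.lTensor A (show A ⊗[R] C from (z : E.Free)))
  left_inv a := by
    change TensorProduct.rid R A (Coalgebra.counit.lTensor A (a ⊗ₜ[R] x)) = a
    rw [LinearMap.lTensor_tmul, hx.counit_eq_one, TensorProduct.rid_tmul, one_smul]
  right_inv z := by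
    obtain ⟨z, hz⟩ := z
    refine Subtype.ext ?_
    have hz' : coact (show A ⊗[R] C from z) = (show A ⊗[R] C from z) ⊗ₜ[R] x :=
      (mem_coinvariants_iff ρA (coaction E) h1 z).1 hz
    change (TensorProduct.rid R A (Coalgebra.counit.lTensor A (show A ⊗[R] C from z)) ⊗ₜ[R] x :
      A ⊗[R] C) = (show A ⊗[R] C from z)
    -- Applying ε to the middle factor of (id ⊗ Δ)(z) recovers z; when (id ⊗ Δ)(z) = z ⊗ x this says
    -- z = (id ⊗ ε)(z) ⊗ x.
    have h2 : ∀ z : A ⊗[R] C, (TensorProduct.rid R A).toLinearMap.rTensor C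
        ((Coalgebra.counit.lTensor A).rTensor C (coact z)) = z := by
      intro z
      induction z with
      | zero => simp
      | add x y hx hy => simp only [map_add, hx, hy]
      | tmul a c =>
        have h3 : ∀ w : C ⊗[R] C, (TensorProduct.rid R A).toLinearMap.rTensor C
            ((Coalgebra.counit.lTensor A).rTensor C ((TensorProduct.mk R A C a).rTensor C w)) =
              a ⊗ₜ[R] TensorProduct.lid R C (Coalgebra.counit.rTensor C w) := by
          intro w
          induction w with
          | zero => simp
          | add x y hx hy => simp only [map_add, TensorProduct.tmul_add, hx, hy]
          | tmul c d => simp [TensorProduct.smul_tmul]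
        rw [coact_tmul, h3, Coalgebra.rTensor_counit_comul, TensorProduct.lid_tmul, one_smul]
    have h4 := h2 z
    rw [hz', LinearMap.rTensor_tmul, LinearMap.rTensor_tmul] at h4
    exact h4

end Free

/-! ### Functoriality of N ⊗_B A, and the Galois property from the weak structure theorem. -/

variable {ρA}

/-- The map `N ⊗_B A → N' ⊗_B A` induced by a right `B`-linear map `N → N'`. -/
def Induced.map {N N' : Type*} [AddCommGroup N] [Module R N]
    [Module (↥(coinvariantSubalgebra ρA))ᵐᵒᵖ N] [AddCommGroup N'] [Module R N']
    [Module (↥(coinvariantSubalgebra ρA))ᵐᵒᵖ N'] (f : N →ₗ[R] N')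
    (hf : ∀ (b : coinvariantSubalgebra ρA) (n : N), f (op b • n) = op b • f n) :
    Induced ρA N →ₗ[R] Induced ρA N' :=
  BalancedTensor.lift (Induced.mk ρA ∘ₗ f) (fun n b a => by
    rw [LinearMap.comp_apply, LinearMap.comp_apply, hf]
    exact Induced.smul_tmul ρA (f n) b a)

lemma Induced.map_tmul {N N' : Type*} [AddCommGroup N] [Module R N]
    [Module (↥(coinvariantSubalgebra ρA))ᵐᵒᵖ N] [AddCommGroup N'] [Module R N']
    [Module (↥(coinvariantSubalgebra ρA))ᵐᵒᵖ N'] (f : N →ₗ[R] N')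
    (hf : ∀ (b : coinvariantSubalgebra ρA) (n : N), f (op b • n) = op b • f n) (n : N) (a : A) :
    Induced.map f hf (Induced.tmul ρA n a) = Induced.tmul ρA (f n) a :=
  BalancedTensor.lift_tmul _ _ n a

lemma Induced.map_bijective {N N' : Type*} [AddCommGroup N] [Module R N]
    [Module (↥(coinvariantSubalgebra ρA))ᵐᵒᵖ N] [AddCommGroup N'] [Module R N']
    [Module (↥(coinvariantSubalgebra ρA))ᵐᵒᵖ N'] (f : N ≃ₗ[R] N')
    (hf : ∀ (b : coinvariantSubalgebra ρA) (n : N), f.toLinearMap (op b • n) = op b • f n) :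
    Function.Bijective (Induced.map f.toLinearMap hf) := by
  have hf' : ∀ (b : coinvariantSubalgebra ρA) (n : N'),
      f.symm.toLinearMap (op b • n) = op b • f.symm n := fun b n => f.injective <| by
    refine (f.apply_symm_apply _).trans ?_
    rw [← LinearEquiv.coe_coe, hf, LinearEquiv.apply_symm_apply]
  refine Function.bijective_iff_has_inverse.2 ⟨Induced.map f.symm.toLinearMap hf',
    fun z => ?_, fun z => ?_⟩
  all_goals
    refine Induced.induction_on ρA z (by simp) (fun n a => ?_)
      (fun x y hx hy => by simp only [_root_.map_add, hx, hy])
    rw [Induced.map_tmul, Induced.map_tmul]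
    simp

/-- Only the entwined module A ⊗ C, which lives in universe `max v w`, is needed. Its coinvariants
are A ⊗ x, and (a' ⊗ x) a = ∑ a' a_ψ ⊗ x^ψ = a' ϱ(a), so Ψ is β up to the identification A ≅ A ⊗ x.
-/
lemma WeakStructureTheorem.isGalois {x : C} (hx : IsGroupLikeElem R x)
    (hρ : ∀ a : A, ρA.ϱ a = E.ψ (x ⊗ₜ[R] a))
    (h : WeakStructureTheorem.{u, v, w, max v w} ρA) : IsGalois ρA := by
  let j := Free.coinvariantsEquiv ρA hx (rho_one ρA hρ)
  have hsmul : ∀ (b a : A), twistedAction (M := A) E.ψ a (b ⊗ₜ[R] x) =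
      (rightOrbit R b).rTensor C (ρA.ϱ a) := fun b a => by
    rw [twistedAction_tmul, hρ]
  -- Right B-linearity of a ↦ a ⊗ x: (a ⊗ x) b = a ϱ(b) = ab ⊗ x because b is coinvariant.
  have hj : ∀ (b : coinvariantSubalgebra ρA) (a : A), j.toLinearMap (op b • a) = op b • j a := by
    intro b a
    refine Subtype.ext ?_
    change (a * (b : A)) ⊗ₜ[R] x = twistedAction (M := A) E.ψ (b : A) (a ⊗ₜ[R] x)
    rw [hsmul, (mem_coinvariants_iff ρA ρA (rho_one ρA hρ) (b : A)).1 b.2,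
      LinearMap.rTensor_tmul, rightOrbit_apply, op_smul_eq_mul]
  have key : (galoisMap ρA : Induced ρA A → A ⊗[R] C) =
      Psi ρA (Free.coaction E) ∘ Induced.map j.toLinearMap hj := by
    funext z
    refine Induced.induction_on ρA z ?_ (fun a' a => ?_) (fun y z hy hz => ?_)
    · rw [map_zero, Function.comp_apply, map_zero, map_zero]; rfl
    · rw [galoisMap_tmul, Function.comp_apply, Induced.map_tmul, Psi_tmul]
      exact (hsmul a' a).symm
    · rw [map_add, Function.comp_apply, map_add, map_add, hy, hz]; rfl
  unfold IsGalois
  rw [key]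
  exact (h E.Free (Free.coaction E)).comp (Induced.map_bijective j hj)

end Free

end EntwiningStructure

/-! ### The equivalence of the five conditions. -/

theorem mainTheorem2 {R : Type u} [CommRing R] {A : Type v} [Ring A] [Algebra R A]
    {C : Type w} [AddCommGroup C] [Module R C] [Coalgebra R C]
    (E : EntwiningStructure R A C) (ρA : E.EntwinedCoaction A)
    (x : C) (hx : IsGroupLikeElem R x) (hρ : ∀ a : A, ρA.ϱ a = E.ψ (x ⊗ₜ[R] a)) :
    List.TFAE
      [ EntwiningStructure.IsCleft ρA,
        EntwiningStructure.StrongStructureTheorem.{u, v, w, max v w} ρA ∧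
          EntwiningStructure.HasRightNormalBasis ρA,
        EntwiningStructure.WeakStructureTheorem.{u, v, w, max v w} ρA ∧
          EntwiningStructure.HasRightNormalBasis ρA,
        EntwiningStructure.IsGalois ρA ∧
          EntwiningStructure.HasRightNormalBasis ρA,
        EntwiningStructure.LamIsRingIso ρA ∧
          EntwiningStructure.HasRightNormalBasis ρA ] := by
  have h1 := EntwiningStructure.rho_one ρA hρ
  have hbasis : EntwiningStructure.IsCleft ρA → EntwiningStructure.HasRightNormalBasis ρA := by
    intro h
    obtain ⟨l, f, hl, hlf, hfl⟩ := (EntwiningStructure.isCleft_iff ρA).1 h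
    obtain ⟨p, hp, -⟩ := hl.exists_isNormalPair h1 hlf hfl
    exact hp.hasRightNormalBasis
  tfae_have 1 → 2 := fun h =>
    ⟨⟨fun M _ _ _ _ ρM => h.bijective_Psi h1 ρM, fun N _ _ _ _ => h.bijective_Phi hx h1 N⟩,
      hbasis h⟩
  tfae_have 2 → 3 := fun h => ⟨h.1.1, h.2⟩
  tfae_have 3 → 4 := fun h => ⟨h.1.isGalois hx hρ, h.2⟩
  tfae_have 4 → 1 := fun h => h.1.isCleft h.2
  tfae_have 1 → 5 := fun h => ⟨h.lamIsRingIso h1, hbasis h⟩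
  tfae_have 5 → 1 := fun h => h.1.isCleft h.2
  tfae_finish
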